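/- Let $M$ be a smooth (Hausdorff, second countable, finite-dimensional, boundaryless) manifold and let $G$ be a compact Lie group acting smoothly and freely on $M$. Let $X\subset M$ be a closed $G$-invariant subset, let $\pi\colon M\to N:=M/G$ be the projection onto the orbit space (with the quotient topology), and put $Y:=X/G=\pi(X)\subset N$. For a smooth manifold $P$ and a subset $A\subset P$ let $\mathcal{J}^\infty(A;P)$ be the ideal of all $f\in\mathcal{C}^\infty(P)=\mathcal{C}^\infty(P,\mathbb{R})$ that are flat on $A$, i.e. such that $(Df)|_A=0$ for every linear differential operator $D$ on $P$ with smooth coefficients. Let $\mathcal{E}^\infty(A;P):=\mathcal{C}^\infty(P)/\mathcal{J}^\infty(A;P)$ be the algebra of Whitney functions on $A$, and let $\mathsf{J}_{A;P}\colon\mathcal{C}^\infty(P)\to\mathcal{E}^\infty(A;P)$ be the quotient map. Let $\mathcal{E}^\infty(X;M)^G:=\mathsf{J}_{X;M}\big(\mathcal{C}^\infty(M)^G\big)$ be the subalgebra of Whitney functions represented by $G$-invariant smooth functions. Then $N$ is Hausdorff and second countable and carries a structure of smooth manifold of dimension $\dim M-\dim G$ for which $\pi$ is a smooth submersion, and $Y$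 is closed in $N$. For every smooth manifold structure on the topological space $N$ for which $\pi$ is a smooth submersion, the assignment $\mathsf{J}_{Y;N}(f)\mapsto\mathsf{J}_{X;M}(f\circ\pi)$, $f\in\mathcal{C}^\infty(N)$, is well defined and is an isomorphism of $\mathbb{R}$-algebras $$\pi^*\colon\mathcal{E}^\infty(Y;N)\;\xrightarrow{\ \cong\ }\;\mathcal{E}^\infty(X;M)^G .$$ -/

import Mathlib

open scoped Manifold ContDiff

noncomputable section

namespace WhitneyFunction

/-- Iterated partial derivatives: `partialDeriv [i₁, …, iₖ] u = ∂_{i₁} ⋯ ∂_{iₖ} u` for a real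
function `u` on `ℝⁿ`. -/
def partialDeriv {n : ℕ} : List (Fin n) → (EuclideanSpace ℝ (Fin n) → ℝ) →
    EuclideanSpace ℝ (Fin n) → ℝ
  | [], u => u
  | i :: w, u => fun y => fderiv ℝ (partialDeriv w u) y (EuclideanSpace.single i 1)

/-- `P` acts on functions that are smooth on `U ⊆ ℝⁿ` as a linear partial differential operator
`∑ a_w ∂_w` of order at most `r`, a finite sum with coefficients `a_w` smooth on `U`. (Partial
derivatives of smooth functions commute, so these are the operators `∑_{|α| ≤ r} a_α ∂^α`.) -/
def IsPartialDiffOp {n : ℕ} (U : Set (EuclideanSpace ℝ (Fin n))) (r : ℕ)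
    (P : (EuclideanSpace ℝ (Fin n) → ℝ) → EuclideanSpace ℝ (Fin n) → ℝ) : Prop :=
  ∃ (S : Finset (List (Fin n))) (a : List (Fin n) → EuclideanSpace ℝ (Fin n) → ℝ),
    (∀ w ∈ S, w.length ≤ r ∧ ContDiffOn ℝ ∞ (a w) U) ∧
    ∀ u : EuclideanSpace ℝ (Fin n) → ℝ, ContDiffOn ℝ ∞ u U →
      ∀ y ∈ U, P u y = ∑ w ∈ S, a w y * partialDeriv w u y

section Leibniz

variable {n : ℕ} {U : Set (EuclideanSpace ℝ (Fin n))} {r : ℕ}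
  {P Q : (EuclideanSpace ℝ (Fin n) → ℝ) → EuclideanSpace ℝ (Fin n) → ℝ}

lemma contDiffOn_partialDeriv (hU : IsOpen U) {u : EuclideanSpace ℝ (Fin n) → ℝ}
    (hu : ContDiffOn ℝ ∞ u U) (w : List (Fin n)) : ContDiffOn ℝ ∞ (partialDeriv w u) U := by
  induction w with
  | nil => exact hu
  | cons i w ih =>
    exact (ih.fderiv_of_isOpen hU (by simp)).clm_apply contDiffOn_const

lemma IsPartialDiffOp.congr (h : IsPartialDiffOp U r P)
    (hPQ : ∀ u, ContDiffOn ℝ ∞ u U → ∀ y ∈ U, Q u y = P u y) : IsPartialDiffOp U r Q := by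
  obtain ⟨S, a, ha, h⟩ := h
  exact ⟨S, a, ha, fun u hu y hy => (hPQ u hu y hy).trans (h u hu y hy)⟩

lemma IsPartialDiffOp.zero : IsPartialDiffOp U r (fun _ _ => 0) :=
  ⟨∅, fun _ _ => 0, by simp, by simp⟩

lemma IsPartialDiffOp.single {w : List (Fin n)} (hw : w.length ≤ r)
    {c : EuclideanSpace ℝ (Fin n) → ℝ} (hc : ContDiffOn ℝ ∞ c U) :
    IsPartialDiffOp U r (fun u y => c y * partialDeriv w u y) :=
  ⟨{w}, fun _ => c, by simp [hw, hc], by simp⟩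

lemma IsPartialDiffOp.add (hP : IsPartialDiffOp U r P) (hQ : IsPartialDiffOp U r Q) :
    IsPartialDiffOp U r (fun u y => P u y + Q u y) := by
  classical
  obtain ⟨S, a, ha, hP⟩ := hP
  obtain ⟨T, b, hb, hQ⟩ := hQ
  refine ⟨S ∪ T, fun w y => (if w ∈ S then a w y else 0) + (if w ∈ T then b w y else 0),
    fun w hw => ⟨?_, ?_⟩, fun u hu y hy => ?_⟩
  · rcases Finset.mem_union.1 hw with h | h
    · exact (ha w h).1
    · exact (hb w h).1
  · refine ContDiffOn.add ?_ ?_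
    · by_cases h : w ∈ S
      · simpa [h] using (ha w h).2
      · simpa [h] using contDiffOn_const
    · by_cases h : w ∈ T
      · simpa [h] using (hb w h).2
      · simpa [h] using contDiffOn_const
  · have h1 : ∑ w ∈ S, a w y * partialDeriv w u y =
        ∑ w ∈ S ∪ T, (if w ∈ S then a w y else 0) * partialDeriv w u y := by
      rw [← Finset.sum_subset Finset.subset_union_left]
      · exact Finset.sum_congr rfl fun w hw => by simp [hw]
      · intro w _ hw
        simp [hw]
    have h2 : ∑ w ∈ T, b w y * partialDeriv w u y =
        ∑ w ∈ S ∪ T, (if w ∈ T then b w y else 0) * partialDeriv w u y := by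
      rw [← Finset.sum_subset Finset.subset_union_right]
      · exact Finset.sum_congr rfl fun w hw => by simp [hw]
      · intro w _ hw
        simp [hw]
    simp only [hP u hu y hy, hQ u hu y hy, h1, h2, ← Finset.sum_add_distrib, add_mul]

lemma IsPartialDiffOp.sum {ι : Type*} (S : Finset ι)
    (R : ι → (EuclideanSpace ℝ (Fin n) → ℝ) → EuclideanSpace ℝ (Fin n) → ℝ)
    (hR : ∀ i ∈ S, IsPartialDiffOp U r (R i)) :
    IsPartialDiffOp U r (fun u y => ∑ i ∈ S, R i u y) := by
  classical
  induction S using Finset.induction_on with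
  | empty => simpa using IsPartialDiffOp.zero
  | insert i S hi ih =>
    simp only [Finset.sum_insert hi]
    exact (hR i (by simp)).add (ih fun j hj => hR j (by simp [hj]))

lemma IsPartialDiffOp.smul (hP : IsPartialDiffOp U r P)
    {c : EuclideanSpace ℝ (Fin n) → ℝ} (hc : ContDiffOn ℝ ∞ c U) :
    IsPartialDiffOp U r (fun u y => c y * P u y) := by
  obtain ⟨S, a, ha, hP⟩ := hP
  refine ⟨S, fun w y => c y * a w y, fun w hw => ⟨(ha w hw).1, hc.mul (ha w hw).2⟩, ?_⟩
  intro u hu y hy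
  simp only [hP u hu y hy, Finset.mul_sum, mul_assoc]

lemma isPartialDiffOp_partialDeriv_mul (hU : IsOpen U) {g : EuclideanSpace ℝ (Fin n) → ℝ}
    (hg : ContDiffOn ℝ ∞ g U) (w : List (Fin n)) :
    IsPartialDiffOp U w.length (fun u => partialDeriv w (g * u)) := by
  induction w with
  | nil =>
    have key : IsPartialDiffOp U 0 (fun u y => g y * partialDeriv [] u y) :=
      IsPartialDiffOp.single (by simp) hg
    exact key.congr fun u _ y _ => rfl
  | cons i w ih =>
    obtain ⟨S, a, ha, h⟩ := ih
    have key : IsPartialDiffOp U (i :: w).length (fun u y => ∑ v ∈ S,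
        (fderiv ℝ (a v) y (EuclideanSpace.single i 1) * partialDeriv v u y +
          a v y * partialDeriv (i :: v) u y)) := by
      refine IsPartialDiffOp.sum S _ fun v hv => ?_
      have hl := (ha v hv).1
      refine IsPartialDiffOp.add (IsPartialDiffOp.single ?_ ?_) (IsPartialDiffOp.single ?_ ?_)
      · simp only [List.length_cons]; omega
      · exact ((ha v hv).2.fderiv_of_isOpen hU (by simp)).clm_apply contDiffOn_const
      · simp only [List.length_cons]; omega
      · exact (ha v hv).2
    refine key.congr fun u hu y hy => ?_
    have hev : partialDeriv w (g * u) =ᶠ[nhds y] fun z => ∑ v ∈ S, a v z * partialDeriv v u z :=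
      Filter.eventuallyEq_of_mem (hU.mem_nhds hy) fun z hz => h u hu z hz
    have hda : ∀ v ∈ S, DifferentiableAt ℝ (a v) y := fun v hv =>
      ((ha v hv).2.contDiffAt (hU.mem_nhds hy)).differentiableAt (by simp)
    have hdu : ∀ v, DifferentiableAt ℝ (partialDeriv v u) y := fun v =>
      ((contDiffOn_partialDeriv hU hu v).contDiffAt (hU.mem_nhds hy)).differentiableAt (by simp)
    change fderiv ℝ (partialDeriv w (g * u)) y _ = _
    rw [hev.fderiv_eq, fderiv_fun_sum fun v hv => (hda v hv).fun_mul (hdu v),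
      ContinuousLinearMap.sum_apply]
    refine Finset.sum_congr rfl fun v hv => ?_
    rw [fderiv_fun_mul (hda v hv) (hdu v)]
    simp only [partialDeriv, ContinuousLinearMap.add_apply, ContinuousLinearMap.smul_apply,
      smul_eq_mul]
    ring

lemma IsPartialDiffOp.comp_mul (hU : IsOpen U) (hP : IsPartialDiffOp U r P)
    {g : EuclideanSpace ℝ (Fin n) → ℝ} (hg : ContDiffOn ℝ ∞ g U) :
    IsPartialDiffOp U r (fun u => P (g * u)) := by
  obtain ⟨S, a, ha, hP⟩ := hP
  have key : IsPartialDiffOp U r (fun u y => ∑ w ∈ S, a w y * partialDeriv w (g * u) y) := by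
    refine IsPartialDiffOp.sum S _ fun w hw => IsPartialDiffOp.smul ?_ (ha w hw).2
    obtain ⟨T, b, hb, h⟩ := isPartialDiffOp_partialDeriv_mul hU hg w
    exact ⟨T, b, fun v hv => ⟨(hb v hv).1.trans (ha w hw).1, (hb v hv).2⟩, h⟩
  exact key.congr fun u hu y hy => hP _ (hg.mul hu) y hy

end Leibniz

section Manifold

variable {n : ℕ} {M : Type*} [TopologicalSpace M] [ChartedSpace (EuclideanSpace ℝ (Fin n)) M]

/-- A linear operator `D` on `C^∞(M)` is a (linear) differential operator of order at most `r` if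
around every point there are smooth coordinates `φ` in which
`(D f) ∘ φ⁻¹ = ∑ a_w ∂_w (f ∘ φ⁻¹)` with smooth coefficients and `|w| ≤ r`. -/
def IsDiffOp (r : ℕ) (D : C^∞⟮𝓡 n, M; ℝ⟯ →ₗ[ℝ] C^∞⟮𝓡 n, M; ℝ⟯) : Prop :=
  ∀ p : M, ∃ φ ∈ IsManifold.maximalAtlas (𝓡 n) ∞ M, p ∈ φ.source ∧
    ∃ P, IsPartialDiffOp φ.target r P ∧
      ∀ f : C^∞⟮𝓡 n, M; ℝ⟯, ∀ y ∈ φ.target, D f (φ.symm y) = P (f ∘ φ.symm) y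

lemma contDiffOn_comp_symm (f : C^∞⟮𝓡 n, M; ℝ⟯)
    {φ : OpenPartialHomeomorph M (EuclideanSpace ℝ (Fin n))}
    (hφ : φ ∈ IsManifold.maximalAtlas (𝓡 n) ∞ M) : ContDiffOn ℝ ∞ (f ∘ φ.symm) φ.target :=
  (f.contMDiff.comp_contMDiffOn (contMDiffOn_symm_of_mem_maximalAtlas hφ)).contDiffOn

lemma IsDiffOp.comp_mul {r : ℕ} {D : C^∞⟮𝓡 n, M; ℝ⟯ →ₗ[ℝ] C^∞⟮𝓡 n, M; ℝ⟯}
    (hD : IsDiffOp r D) (g : C^∞⟮𝓡 n, M; ℝ⟯) : IsDiffOp r (D ∘ₗ LinearMap.mulLeft ℝ g) := by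
  intro p
  obtain ⟨φ, hφ, hp, P, hP, h⟩ := hD p
  exact ⟨φ, hφ, hp, _, hP.comp_mul φ.open_target (contDiffOn_comp_symm g hφ),
    fun f y hy => h (g * f) y hy⟩

/-- The ideal `J^∞(X, M)` of smooth functions that are flat on `X`, that is, all of whose images
under differential operators on `M` vanish on `X`. -/
def flatIdeal (X : Set M) : Ideal C^∞⟮𝓡 n, M; ℝ⟯ where
  carrier := {f | ∀ (r : ℕ) (D : C^∞⟮𝓡 n, M; ℝ⟯ →ₗ[ℝ] C^∞⟮𝓡 n, M; ℝ⟯), IsDiffOp r D →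
    ∀ x ∈ X, D f x = 0}
  zero_mem' := fun r D _ x _ => by rw [map_zero]; rfl
  add_mem' := fun {f g} hf hg r D hD x hx => by
    rw [map_add]
    change D f x + D g x = 0
    rw [hf r D hD x hx, hg r D hD x hx, add_zero]
  smul_mem' := fun c f hf r D hD x hx => hf r _ (hD.comp_mul c) x hx

/-- The algebra `E^∞(X; M) = C^∞(M) / J^∞(X, M)` of Whitney functions on `X ⊆ M`. -/
abbrev WhitneyAlgebra (n : ℕ) {M : Type*} [TopologicalSpace M]
    [ChartedSpace (EuclideanSpace ℝ (Fin n)) M] (X : Set M) : Type _ :=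
  C^∞⟮𝓡 n, M; ℝ⟯ ⧸ flatIdeal (n := n) X

/-- The jet map `J_{X;M} : C^∞(M) → E^∞(X; M)`, the canonical projection. -/
def jetMap (X : Set M) : C^∞⟮𝓡 n, M; ℝ⟯ →ₐ[ℝ] WhitneyAlgebra n X :=
  Ideal.Quotient.mkₐ ℝ (flatIdeal X)

/-- The algebra `C^∞(M)^G` of `G`-invariant smooth functions. -/
def invariantFunctions (n : ℕ) (G M : Type*) [TopologicalSpace M]
    [ChartedSpace (EuclideanSpace ℝ (Fin n)) M] [Group G] [MulAction G M] :
    Subalgebra ℝ C^∞⟮𝓡 n, M; ℝ⟯ where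
  carrier := {f | ∀ (g : G) (x : M), f (g • x) = f x}
  mul_mem' := fun {a b} ha hb g x => by
    change a (g • x) * b (g • x) = a x * b x
    rw [ha, hb]
  add_mem' := fun {a b} ha hb g x => by
    change a (g • x) + b (g • x) = a x + b x
    rw [ha, hb]
  algebraMap_mem' := fun _ _ _ => rfl

/-- The algebra `E^∞(X; M)^G` of Whitney functions represented by `G`-invariant smooth functions,
the image of `C^∞(M)^G` under the jet map. -/
def invariantWhitneyAlgebra (n : ℕ) (G : Type*) {M : Type*} [TopologicalSpace M]
    [ChartedSpace (EuclideanSpace ℝ (Fin n)) M] [Group G] [MulAction G M] (X : Set M) :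
    Subalgebra ℝ (WhitneyAlgebra n X) :=
  (invariantFunctions n G M).map (jetMap X)

/-- The canonical projection `π : M → M/G` onto the orbit space (with the quotient topology). -/
def orbitProj (G M : Type*) [Group G] [MulAction G M] : M → MulAction.orbitRel.Quotient G M :=
  Quotient.mk (MulAction.orbitRel G M)

end Manifold

end WhitneyFunction

end

noncomputable section

namespace WhitneyFunction

/-! Flatness is a pointwise condition: `f` lies in `flatIdeal X` iff at every `x ∈ X` all
derivatives of `f` in a chart vanish (`mem_flatIdeal_iff`; bump functions turn chartwise partial
derivatives into global operators). By the chain rule for higher derivatives, flatness survives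
pull-back along any smooth map (`FlatAt.pullback`). A submersion `π` has a smooth local section
through each point of `M`. Pulling back along `π` and along sections shows that `f ∘ π` is flat on
`X` iff `f` is flat on `π(X)` (`comp_mem_flatIdeal_iff`), which gives well-definedness and
injectivity at once. Surjectivity holds because an invariant function is constant on fibres and its
descent is, locally, its composite with a section.

The smooth structure on `M/G` comes from slices. Freeness makes the orbit map an immersion at the
unit (`eq_zero_of_fderiv_orbitMap_eq_zero`), so the action restricted to a transversal `w ↦ s w` is
a local diffeomorphism `(w, a) ↦ a • s w`. Compactness of `G` ensures that, near `x`, only group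
elements near `1` can relate two points (`exists_nhds_forall_smul_mem`), so a small transversal
meets each orbit at most once (`exists_sliceChart`). Hence `w` is a coordinate on the orbit space.
-/

open Set Filter Topology

/-! ### Flatness in normed spaces, the chain rule and partial derivatives. -/

section Flat

variable {E F G : Type*} [NormedAddCommGroup E] [NormedSpace ℝ E] [NormedAddCommGroup F]
  [NormedSpace ℝ F] [NormedAddCommGroup G] [NormedSpace ℝ G]

/-- All derivatives of `u`, including `u` itself, vanish at `x`. -/
def FlatAt (u : E → F) (x : E) : Prop := ∀ j : ℕ, iteratedFDeriv ℝ j u x = 0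

lemma FlatAt.congr {u v : E → F} {x : E} (hu : FlatAt u x) (h : v =ᶠ[𝓝 x] u) : FlatAt v x :=
  fun j => (h.iteratedFDeriv ℝ j).eq_of_nhds.trans (hu j)

lemma FlatAt.eq_zero {u : E → F} {x : E} (hu : FlatAt u x) : u x = 0 := by
  have h := hu 0
  rw [← norm_eq_zero, norm_iteratedFDeriv_zero] at h
  simpa using h

/-- The Faà di Bruno estimate `j! * C * D ^ j` bounds the `j`-th derivative of a composite, where
`C` bounds the derivatives of the outer map. Flatness permits `C = 0`. -/
lemma FlatAt.comp {g : F → G} {f : E → F} {x : E} (hg : FlatAt g (f x))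
    (hgs : ContDiffAt ℝ ∞ g (f x)) (hfs : ContDiffAt ℝ ∞ f x) : FlatAt (g ∘ f) x := by
  intro j
  obtain ⟨v, hv, hgv⟩ := (hgs.of_le (m := (j : ℕ∞ω)) (by exact_mod_cast le_top)).contDiffOn
    le_rfl (by simp)
  obtain ⟨u, hu, hfu⟩ := (hfs.of_le (m := (j : ℕ∞ω)) (by exact_mod_cast le_top)).contDiffOn
    le_rfl (by simp)
  obtain ⟨t, htv, ht, hxt⟩ := mem_nhds_iff.1 hv
  obtain ⟨s, hsu, hs, hxs⟩ := mem_nhds_iff.1 (inter_mem hu (hfs.continuousAt.preimage_mem_nhds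
    (ht.mem_nhds hxt)))
  -- The estimate asks for the bound `D ^ i` on the `i`-th derivative; with `1 ≤ D` a uniform bound
  -- `D` suffices.
  obtain ⟨D, hD1, hD⟩ : ∃ D : ℝ, 1 ≤ D ∧ ∀ i ≤ j, ‖iteratedFDeriv ℝ i f x‖ ≤ D := by
    refine ⟨1 + ∑ i ∈ Finset.range (j + 1), ‖iteratedFDeriv ℝ i f x‖, ?_, fun i hi => ?_⟩
    · have := Finset.sum_nonneg fun i (_ : i ∈ Finset.range (j + 1)) =>
        norm_nonneg (iteratedFDeriv ℝ i f x)
      linarith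
    · have := Finset.single_le_sum (f := fun i => ‖iteratedFDeriv ℝ i f x‖)
        (fun i _ => norm_nonneg _) (Finset.mem_range.2 (Nat.lt_succ_of_le hi))
      linarith
  have key := norm_iteratedFDerivWithin_comp_le (n := j) (x := x) (C := 0) (D := D)
    (hgv.mono htv) (hfu.mono fun y hy => (hsu hy).1) le_rfl ht.uniqueDiffOn hs.uniqueDiffOn
    (fun y hy => (hsu hy).2) hxs
    (fun i _ => by rw [iteratedFDerivWithin_of_isOpen i ht hxt, hg i, norm_zero])
    (fun i hi hij => by
      rw [iteratedFDerivWithin_of_isOpen i hs hxs]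
      exact (hD i hij).trans (le_self_pow₀ hD1 (by omega)))
  rw [iteratedFDerivWithin_of_isOpen j hs hxs, mul_zero, zero_mul] at key
  exact norm_le_zero_iff.1 key

lemma FlatAt.fderiv_apply {u : E → F} {x : E} (hu : FlatAt u x) (hus : ContDiffAt ℝ ∞ u x)
    (v : E) : FlatAt (fun y => fderiv ℝ u y v) x := by
  intro j
  have h := norm_iteratedFDeriv_clm_apply_const (c := v) (n := j)
    (hus.fderiv_right (m := ∞) (by simp)) (by exact_mod_cast le_top)
  rw [norm_iteratedFDeriv_fderiv, hu (j + 1), norm_zero, mul_zero] at h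
  exact norm_le_zero_iff.1 h

end Flat

section PartialDeriv

variable {n : ℕ} {U : Set (EuclideanSpace ℝ (Fin n))} {u : EuclideanSpace ℝ (Fin n) → ℝ}

lemma FlatAt.partialDeriv (hU : IsOpen U) (hu : ContDiffOn ℝ ∞ u U)
    {x : EuclideanSpace ℝ (Fin n)} (hx : x ∈ U) (h : FlatAt u x) (w : List (Fin n)) :
    FlatAt (partialDeriv w u) x := by
  induction w with
  | nil => exact h
  | cons i w ih =>
    exact ih.fderiv_apply ((contDiffOn_partialDeriv hU hu w).contDiffAt (hU.mem_nhds hx)) _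

lemma iteratedFDeriv_single_eq_partialDeriv (hU : IsOpen U) (hu : ContDiffOn ℝ ∞ u U) (j : ℕ)
    (k : Fin j → Fin n) {x : EuclideanSpace ℝ (Fin n)} (hx : x ∈ U) :
    iteratedFDeriv ℝ j u x (fun i => EuclideanSpace.single (k i) 1) =
      partialDeriv (List.ofFn k) u x := by
  induction j generalizing x with
  | zero => simp [partialDeriv]
  | succ j ih =>
    rw [iteratedFDeriv_succ_apply_left, List.ofFn_succ]
    have hd : DifferentiableAt ℝ (iteratedFDeriv ℝ j u) x :=
      ((hu.contDiffAt (hU.mem_nhds hx)).iteratedFDeriv_right (m := 1) (i := j)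
        (by exact_mod_cast le_top)).differentiableAt (by simp)
    have hev : partialDeriv (List.ofFn fun i => k i.succ) u =ᶠ[𝓝 x] fun y =>
        iteratedFDeriv ℝ j u y (fun i => EuclideanSpace.single (k i.succ) 1) :=
      eventuallyEq_of_mem (hU.mem_nhds hx) fun y hy => (ih _ hy).symm
    change _ = fderiv ℝ (partialDeriv (List.ofFn fun i => k i.succ) u) x _
    rw [hev.fderiv_eq, fderiv_continuousMultilinear_apply_const_apply hd]
    rfl

/-- A multilinear map is determined by its values on basis vectors, and for the iterated derivative
these values are the iterated partial derivatives. -/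
lemma flatAt_of_partialDeriv_eq_zero (hU : IsOpen U) (hu : ContDiffOn ℝ ∞ u U)
    {x : EuclideanSpace ℝ (Fin n)} (hx : x ∈ U) (h : ∀ w, partialDeriv w u x = 0) :
    FlatAt u x := by
  intro j
  apply ContinuousMultilinearMap.toMultilinearMap_injective
  refine Module.Basis.ext_multilinear
    (fun _ => (EuclideanSpace.basisFun (Fin n) ℝ).toBasis) fun k => ?_
  simpa using (iteratedFDeriv_single_eq_partialDeriv hU hu j k hx).trans (h _)

end PartialDeriv

/-! ### The inverse function theorem and immersivity of injective orbit maps. -/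

section InverseFunction

variable {E F : Type*} [NormedAddCommGroup E] [NormedSpace ℝ E] [CompleteSpace E]
  [NormedAddCommGroup F] [NormedSpace ℝ F]

/-- The inverse function theorem for smooth maps. -/
lemma exists_openPartialHomeomorph_of_contDiffOn {f : E → F} {O : Set E} (hO : IsOpen O)
    (hf : ContDiffOn ℝ ∞ f O) {x : E} (hx : x ∈ O) {f' : E ≃L[ℝ] F}
    (hf' : HasFDerivAt f (f' : E →L[ℝ] F) x) :
    ∃ Ψ : OpenPartialHomeomorph E F, x ∈ Ψ.source ∧ Ψ.source ⊆ O ∧ (Ψ : E → F) = f ∧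
      ContDiffOn ℝ ∞ Ψ.symm Ψ.target := by
  have hfx := hf.contDiffAt (hO.mem_nhds hx)
  let Φ := hfx.toOpenPartialHomeomorph f hf' (by simp)
  have hcont : ContinuousOn (fderiv ℝ f) O := hf.continuousOn_fderiv_of_isOpen hO (by simp)
  -- Restricting to the open set where the derivative is invertible makes the inverse smooth on the
  -- whole target, not only at the image of `x`.
  let T : Set E := O ∩ fderiv ℝ f ⁻¹' (Set.range ((↑) : (E ≃L[ℝ] F) → E →L[ℝ] F))
  have hT : IsOpen T := hcont.isOpen_inter_preimage hO ContinuousLinearEquiv.isOpen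
  have hxT : x ∈ T := ⟨hx, f', hf'.fderiv.symm⟩
  refine ⟨Φ.restrOpen T hT, ⟨hfx.mem_toOpenPartialHomeomorph_source hf' (by simp), hxT⟩,
    fun y hy => hy.2.1, rfl, fun y hy => ContDiffAt.contDiffWithinAt ?_⟩
  obtain ⟨hy1, e, he⟩ := ((Φ.restrOpen T hT).map_target hy).2
  refine OpenPartialHomeomorph.contDiffAt_symm _ (f₀' := e) hy ?_ ?_
  · rw [he]
    exact ((hf.contDiffAt (hO.mem_nhds hy1)).differentiableAt (by simp)).hasFDerivAt
  · exact hf.contDiffAt (hO.mem_nhds hy1)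

end InverseFunction

section LocalGroup

variable {E F : Type*} [NormedAddCommGroup E] [NormedSpace ℝ E] [CompleteSpace E]
  [NormedAddCommGroup F] [NormedSpace ℝ F]

/-- An orbit map `f` of a local group with multiplication `μ` and unit `a₀` (both read in a chart)
which is injective near the unit has injective derivative there. -/
lemma eq_zero_of_fderiv_orbitMap_eq_zero {μ : E × E → E} {f : E → F} {a₀ : E}
    (hμ : ContDiffAt ℝ 2 μ (a₀, a₀)) (hf : ContDiffAt ℝ 1 f a₀)
    (hr : ∀ᶠ a in 𝓝 a₀, μ (a, a₀) = a) (hl : ∀ᶠ b in 𝓝 a₀, μ (a₀, b) = b)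
    (hequiv : ∀ᶠ a in 𝓝 a₀, ∃ H : F → F, DifferentiableAt ℝ H (f a₀) ∧
      ∀ᶠ b in 𝓝 a₀, f (μ (a, b)) = H (f b))
    (hinj : ∀ᶠ a in 𝓝 a₀, f a = f a₀ → a = a₀) {v : E} (hv : fderiv ℝ f a₀ v = 0) : v = 0 := by
  -- The left-invariant vector field with value `v` at the unit.
  let V : E → E := fun a => fderiv ℝ μ (a, a₀) (0, v)
  have hpair : ContDiffAt ℝ 1 (fun a : E => (a, a₀)) a₀ := contDiffAt_id.prodMk contDiffAt_const
  have hV : ContDiffAt ℝ 1 V a₀ :=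
    ((hμ.fderiv_right (m := 1) (by norm_num)).comp (f := fun a : E => (a, a₀)) a₀ hpair).clm_apply
      contDiffAt_const
  have hμd : ∀ᶠ a in 𝓝 a₀, DifferentiableAt ℝ μ (a, a₀) :=
    hpair.continuousAt.eventually
      ((hμ.eventually (by simp)).mono fun p hp => hp.differentiableAt (by simp))
  have hslice : ∀ a, DifferentiableAt ℝ μ (a, a₀) →
      HasFDerivAt (fun b => μ (a, b)) ((fderiv ℝ μ (a, a₀)).comp
        (ContinuousLinearMap.inr ℝ E E)) a₀ := fun a ha =>
    ha.hasFDerivAt.comp a₀ (hasFDerivAt_prodMk_right a a₀)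
  have hker : ∀ᶠ a in 𝓝 a₀, DifferentiableAt ℝ f a ∧ fderiv ℝ f a (V a) = 0 := by
    filter_upwards [hμd, hr, hequiv, hf.eventually (by simp)] with a ha hra ⟨H, hH, hHf⟩ hfa
    have hfa := hfa.differentiableAt (by simp)
    refine ⟨hfa, ?_⟩
    -- Differentiating `f (μ (a, b)) = H (f b)` at `b = a₀` in direction `v` gives `df (V a)` on one
    -- side and `dH (df v) = 0` on the other.
    have h1 : HasFDerivAt (fun b => f (μ (a, b))) ((fderiv ℝ f a).comp
        ((fderiv ℝ μ (a, a₀)).comp (ContinuousLinearMap.inr ℝ E E))) a₀ := by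
      refine HasFDerivAt.comp (g := f) a₀ ?_ (hslice a ha)
      rw [hra]
      exact hfa.hasFDerivAt
    have h2 : HasFDerivAt (fun b => f (μ (a, b))) ((fderiv ℝ H (f a₀)).comp (fderiv ℝ f a₀)) a₀ :=
      (hH.hasFDerivAt.comp a₀ (hf.differentiableAt (by simp)).hasFDerivAt).congr_of_eventuallyEq
        hHf
    have h3 := congrArg (fun L => L v) (h1.unique h2)
    simpa [hv, V] using h3
  obtain ⟨α, hα0, ε, hε, hα⟩ :=
    hV.exists_forall_mem_closedBall_exists_eq_forall_mem_Ioo_hasDerivAt₀ 0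
  have hα' : ∀ᶠ t in 𝓝 (0 : ℝ), HasDerivAt α (V (α t)) t :=
    eventually_of_mem (Ioo_mem_nhds (by linarith) (by linarith)) hα
  have hαc : Tendsto α (𝓝 0) (𝓝 a₀) := by
    have := hα'.self_of_nhds.continuousAt
    rwa [ContinuousAt, hα0] at this
  -- Along the integral curve `α` of `V`, `f ∘ α` solves `y' = 0`, so it is locally constant;
  -- injectivity of `f` then freezes `α`, forcing `V a₀ = 0`.
  have hconst : f ∘ α =ᶠ[𝓝 0] fun _ => f a₀ := by
    refine ODE_solution_unique_of_eventually (v := fun _ _ => (0 : F)) (s := fun _ => univ) (K := 0)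
      (Eventually.of_forall fun _ => (LipschitzWith.const 0).lipschitzOnWith)
      ?_ (Eventually.of_forall fun t => ⟨hasDerivAt_const t _, mem_univ _⟩) (by simp [hα0])
    filter_upwards [hα', hαc.eventually hker] with t ht ⟨hd, h0⟩
    refine ⟨?_, mem_univ _⟩
    have := hd.hasFDerivAt.comp_hasDerivAt t ht
    rwa [h0] at this
  have hαconst : α =ᶠ[𝓝 0] fun _ => a₀ := by
    filter_upwards [hconst, hαc.eventually hinj] with t ht h using h ht
  have hV0 : V a₀ = 0 := by
    have h := hα'.self_of_nhds
    rw [hα0] at h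
    exact h.unique ((hasDerivAt_const 0 a₀).congr_of_eventuallyEq hαconst)
  have hVv : V a₀ = v := by
    have h1 := (hslice a₀ hμd.self_of_nhds).unique
      ((hasFDerivAt_id a₀).congr_of_eventuallyEq (f₁ := fun b => μ (a₀, b)) hl)
    simpa [V] using congrArg (fun L => L v) h1
  rw [← hVv, hV0]

end LocalGroup

/-! ### Flat ideals on manifolds, read in charts. -/

section PartialDeriv

variable {n : ℕ} {U : Set (EuclideanSpace ℝ (Fin n))} {u v : EuclideanSpace ℝ (Fin n) → ℝ}

lemma partialDeriv_add (hU : IsOpen U) (hu : ContDiffOn ℝ ∞ u U) (hv : ContDiffOn ℝ ∞ v U)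
    (w : List (Fin n)) {x : EuclideanSpace ℝ (Fin n)} (hx : x ∈ U) :
    partialDeriv w (u + v) x = partialDeriv w u x + partialDeriv w v x := by
  induction w generalizing x with
  | nil => rfl
  | cons i w ih =>
    have hev : partialDeriv w (u + v) =ᶠ[𝓝 x] partialDeriv w u + partialDeriv w v :=
      eventuallyEq_of_mem (hU.mem_nhds hx) fun y hy => ih hy
    have hd : ∀ {u}, ContDiffOn ℝ ∞ u U → DifferentiableAt ℝ (partialDeriv w u) x := fun hu =>
      ((contDiffOn_partialDeriv hU hu w).contDiffAt (hU.mem_nhds hx)).differentiableAt (by simp)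
    change fderiv ℝ _ x _ = fderiv ℝ _ x _ + fderiv ℝ _ x _
    rw [hev.fderiv_eq, fderiv_add (hd hu) (hd hv), add_apply]

lemma partialDeriv_const_smul (hU : IsOpen U) (hu : ContDiffOn ℝ ∞ u U) (c : ℝ)
    (w : List (Fin n)) {x : EuclideanSpace ℝ (Fin n)} (hx : x ∈ U) :
    partialDeriv w (c • u) x = c * partialDeriv w u x := by
  induction w generalizing x with
  | nil => rfl
  | cons i w ih =>
    have hev : partialDeriv w (c • u) =ᶠ[𝓝 x] c • partialDeriv w u :=
      eventuallyEq_of_mem (hU.mem_nhds hx) fun y hy => ih hy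
    have hd : DifferentiableAt ℝ (partialDeriv w u) x :=
      ((contDiffOn_partialDeriv hU hu w).contDiffAt (hU.mem_nhds hx)).differentiableAt (by simp)
    change fderiv ℝ _ x _ = c * fderiv ℝ _ x _
    rw [hev.fderiv_eq, fderiv_const_smul hd, smul_apply, smul_eq_mul]

end PartialDeriv

section Manifold

variable {m d : ℕ}
  {M : Type*} [TopologicalSpace M] [ChartedSpace (EuclideanSpace ℝ (Fin m)) M]
  {N : Type*} [TopologicalSpace N] [ChartedSpace (EuclideanSpace ℝ (Fin d)) N]

/-- Flatness at a point, expressed in arbitrary charts, is preserved by pull-back along smooth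
maps. -/
lemma FlatAt.pullback {h : M → N} {x : M} (hh : ContMDiffAt (𝓡 m) (𝓡 d) ∞ h x)
    {φ : OpenPartialHomeomorph M (EuclideanSpace ℝ (Fin m))}
    (hφ : φ ∈ IsManifold.maximalAtlas (𝓡 m) ∞ M) (hx : x ∈ φ.source)
    {ψ : OpenPartialHomeomorph N (EuclideanSpace ℝ (Fin d))}
    (hψ : ψ ∈ IsManifold.maximalAtlas (𝓡 d) ∞ N) (hhx : h x ∈ ψ.source)
    {f : C^∞⟮𝓡 d, N; ℝ⟯} {g : M → ℝ} (hg : g =ᶠ[𝓝 x] f ∘ h)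
    (hf : FlatAt (f ∘ ψ.symm) (ψ (h x))) : FlatAt (g ∘ φ.symm) (φ x) := by
  have hsx : φ.symm (φ x) = x := φ.left_inv hx
  have hφc : Tendsto φ.symm (𝓝 (φ x)) (𝓝 x) := by
    simpa only [ContinuousAt, hsx] using φ.continuousAt_symm (φ.map_source hx)
  have hψd : ContMDiffAt (𝓡 m) (𝓡 d) ∞ (ψ ∘ h) x :=
    (contMDiffAt_of_mem_maximalAtlas hψ hhx).comp x hh
  have hk : ContDiffAt ℝ ∞ (ψ ∘ h ∘ φ.symm) (φ x) := by
    rw [← contMDiffAt_iff_contDiffAt]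
    refine ContMDiffAt.comp (g := ψ ∘ h) (f := φ.symm) (φ x) ?_
      (contMDiffAt_symm_of_mem_maximalAtlas hφ (φ.map_source hx))
    rwa [hsx]
  have hkx : (ψ ∘ h ∘ φ.symm) (φ x) = ψ (h x) := by simp [hsx]
  have key : FlatAt ((f ∘ ψ.symm) ∘ (ψ ∘ h ∘ φ.symm)) (φ x) := by
    refine FlatAt.comp ?_ ?_ hk
    · rwa [hkx]
    · rw [hkx]
      exact (contDiffOn_comp_symm f hψ).contDiffAt (ψ.open_target.mem_nhds (ψ.map_source hhx))
  refine key.congr ?_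
  filter_upwards [hφc.eventually hg, hφc.eventually
    (hh.continuousAt.preimage_mem_nhds (ψ.open_source.mem_nhds hhx))] with y hy hy'
  simp only [Function.comp_apply] at hy ⊢
  rw [hy, ψ.left_inv hy']

variable [T2Space M] [IsManifold (𝓡 m) ∞ M]

/-- The iterated partial derivative `∂_w` in the chart at `x`, cut off by a bump function. -/
def cutoffPartialDeriv {x : M} (b : SmoothBumpFunction (𝓡 m) x) (w : List (Fin m)) :
    C^∞⟮𝓡 m, M; ℝ⟯ →ₗ[ℝ] C^∞⟮𝓡 m, M; ℝ⟯ where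
  toFun f := ⟨fun y => b y • partialDeriv w
      (f ∘ (chartAt (EuclideanSpace ℝ (Fin m)) x).symm) (chartAt (EuclideanSpace ℝ (Fin m)) x y), by
    refine b.contMDiff_smul ?_
    have h1 := contDiffOn_partialDeriv (chartAt (EuclideanSpace ℝ (Fin m)) x).open_target
      (contDiffOn_comp_symm f (IsManifold.chart_mem_maximalAtlas x)) w
    exact h1.contMDiffOn.comp (contMDiffOn_chart (I := 𝓡 m) (n := ∞)) fun y hy =>
      (chartAt (EuclideanSpace ℝ (Fin m)) x).map_source hy⟩
  map_add' f g := by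
    ext y
    by_cases hy : y ∈ (chartAt (EuclideanSpace ℝ (Fin m)) x).source
    · have := partialDeriv_add (chartAt (EuclideanSpace ℝ (Fin m)) x).open_target
        (contDiffOn_comp_symm f (IsManifold.chart_mem_maximalAtlas x))
        (contDiffOn_comp_symm g (IsManifold.chart_mem_maximalAtlas x)) w
        ((chartAt (EuclideanSpace ℝ (Fin m)) x).map_source hy)
      change b y * partialDeriv w (f ∘ _ + g ∘ _) _ = b y * _ + b y * _
      rw [this, mul_add]
    · have hb : b y = 0 := by
        by_contra h
        exact hy (b.support_subset_source h)
      change b y * _ = b y * _ + b y * _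
      simp [hb]
  map_smul' c f := by
    ext y
    by_cases hy : y ∈ (chartAt (EuclideanSpace ℝ (Fin m)) x).source
    · have := partialDeriv_const_smul (chartAt (EuclideanSpace ℝ (Fin m)) x).open_target
        (contDiffOn_comp_symm f (IsManifold.chart_mem_maximalAtlas x)) c w
        ((chartAt (EuclideanSpace ℝ (Fin m)) x).map_source hy)
      change b y * partialDeriv w (c • (f ∘ _)) _ = c * (b y * _)
      rw [this]
      ring
    · have hb : b y = 0 := by
        by_contra h
        exact hy (b.support_subset_source h)
      change b y * _ = c * (b y * _)
      simp [hb]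

lemma cutoffPartialDeriv_apply {x : M} (b : SmoothBumpFunction (𝓡 m) x) (w : List (Fin m))
    (f : C^∞⟮𝓡 m, M; ℝ⟯) (y : M) : cutoffPartialDeriv b w f y = b y * partialDeriv w
      (f ∘ (chartAt (EuclideanSpace ℝ (Fin m)) x).symm) (chartAt (EuclideanSpace ℝ (Fin m)) x y) :=
  rfl

lemma isDiffOp_cutoffPartialDeriv {x : M} (b : SmoothBumpFunction (𝓡 m) x) (w : List (Fin m)) :
    IsDiffOp w.length (cutoffPartialDeriv b w) := by
  intro p
  by_cases hp : p ∈ (chartAt (EuclideanSpace ℝ (Fin m)) x).source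
  · refine ⟨_, IsManifold.chart_mem_maximalAtlas x, hp, _, IsPartialDiffOp.single le_rfl
      (contDiffOn_comp_symm ⟨b, b.contMDiff⟩ (IsManifold.chart_mem_maximalAtlas x)),
      fun f y hy => ?_⟩
    rw [cutoffPartialDeriv_apply, (chartAt (EuclideanSpace ℝ (Fin m)) x).right_inv hy]
    rfl
  -- Outside the chart domain of `x`, coordinates avoiding the support of `b` turn the operator into
  -- zero.
  · have ho : IsOpen (tsupport b)ᶜ := (isClosed_tsupport _).isOpen_compl
    refine ⟨(chartAt _ p).restr (tsupport b)ᶜ, restr_mem_maximalAtlas _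
      (IsManifold.chart_mem_maximalAtlas p) ho, ?_, _, IsPartialDiffOp.zero, fun f y hy => ?_⟩
    · rw [OpenPartialHomeomorph.restr_source, ho.interior_eq]
      exact ⟨mem_chart_source _ p, fun h => hp (b.tsupport_subset_chartAt_source h)⟩
    · have h := ((chartAt (EuclideanSpace ℝ (Fin m)) p).restr (tsupport b)ᶜ).map_target hy
      rw [OpenPartialHomeomorph.restr_source, ho.interior_eq] at h
      rw [cutoffPartialDeriv_apply, image_eq_zero_of_notMem_tsupport h.2, zero_mul]

/-- Cut-off partial derivatives are enough operators to detect every derivative at `x`. Conversely,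
any operator is, in its own coordinates, a combination of partial derivatives, and flatness does not
depend on the chart. -/
lemma mem_flatIdeal_iff {X : Set M} {f : C^∞⟮𝓡 m, M; ℝ⟯} :
    f ∈ flatIdeal X ↔ ∀ x ∈ X, FlatAt (f ∘ (chartAt (EuclideanSpace ℝ (Fin m)) x).symm)
      (chartAt (EuclideanSpace ℝ (Fin m)) x x) := by
  constructor
  · intro hf x hx
    refine flatAt_of_partialDeriv_eq_zero (chartAt (EuclideanSpace ℝ (Fin m)) x).open_target
      (contDiffOn_comp_symm f (IsManifold.chart_mem_maximalAtlas x))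
      ((chartAt _ x).map_source (mem_chart_source _ x)) fun w => ?_
    obtain ⟨b⟩ : Nonempty (SmoothBumpFunction (𝓡 m) x) := inferInstance
    have h := hf _ _ (isDiffOp_cutoffPartialDeriv b w) x hx
    rwa [cutoffPartialDeriv_apply, b.eq_one, one_mul] at h
  · intro hf r D hD x hx
    obtain ⟨φ, hφ, hxφ, P, ⟨S, a, ha, hP⟩, hDP⟩ := hD x
    have hflat : FlatAt (f ∘ φ.symm) (φ x) :=
      FlatAt.pullback (h := id) contMDiffAt_id hφ hxφ (IsManifold.chart_mem_maximalAtlas x)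
        (mem_chart_source _ x) (EventuallyEq.refl _ _) (hf x hx)
    have hfs := contDiffOn_comp_symm f hφ
    have h := hDP f _ (φ.map_source hxφ)
    rw [φ.left_inv hxφ] at h
    rw [h, hP _ hfs _ (φ.map_source hxφ)]
    refine Finset.sum_eq_zero fun w _ => ?_
    rw [(hflat.partialDeriv φ.open_target hfs (φ.map_source hxφ) w).eq_zero, mul_zero]

end Manifold

/-! ### Pull-back along submersions. -/

section Submersion

variable {m d : ℕ}
  {M : Type*} [TopologicalSpace M] [ChartedSpace (EuclideanSpace ℝ (Fin m)) M]
  {N : Type*} [TopologicalSpace N] [ChartedSpace (EuclideanSpace ℝ (Fin d)) N]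

/-- A submersion has smooth local sections. -/
lemma exists_localSection {p : M → N} (hp : Manifold.IsSubmersion (𝓡 m) (𝓡 d) ∞ p) (x : M) :
    ∃ σ : N → M, ContMDiffAt (𝓡 d) (𝓡 m) ∞ σ (p x) ∧ σ (p x) = x ∧
      ∀ᶠ y in 𝓝 (p x), p (σ y) = y := by
  obtain ⟨F, _, _, hF⟩ := hp
  have h := hF x
  set φ := h.domChart
  set ψ := h.codChart
  set e := h.equiv
  have hφx : x ∈ φ.source := h.mem_domChart_source
  have hψx : p x ∈ ψ.source := h.mem_codChart_source
  have hw : ∀ z ∈ φ.target, ψ (p (φ.symm z)) = (e z).1 := fun z hz => by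
    have := h.writtenInCharts (show z ∈ (φ.extend (𝓡 m)).target by simpa using hz)
    simpa using this
  have hs : ∀ z ∈ φ.target, p (φ.symm z) ∈ ψ.source := fun z hz =>
    h.mapsto_domChart_source_codChart_source (φ.map_target hz)
  -- In adapted coordinates the submersion is a projection; the section keeps the complementary
  -- coordinate at its value at `x`, so that it passes through `x`.
  set c : F := (e (φ x)).2
  have hsm : ContMDiffAt (𝓡 d) (𝓡 m) ∞ (fun y => e.symm (ψ y, c)) (p x) := by
    have h1 : ContDiff ℝ ∞ fun v : EuclideanSpace ℝ (Fin d) => e.symm (v, c) :=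
      e.symm.contDiff.comp (contDiff_id.prodMk contDiff_const)
    exact h1.contMDiff.contMDiffAt.comp _
      (contMDiffAt_of_mem_maximalAtlas h.codChart_mem_maximalAtlas hψx)
  have hz0 : e.symm (ψ (p x), c) = φ x := by
    have := hw _ (φ.map_source hφx)
    rw [φ.left_inv hφx] at this
    rw [this]
    exact e.symm_apply_apply _
  refine ⟨fun y => φ.symm (e.symm (ψ y, c)), ?_, ?_, ?_⟩
  · refine ContMDiffAt.comp (g := φ.symm) (p x) ?_ hsm
    rw [hz0]
    exact contMDiffAt_symm_of_mem_maximalAtlas h.domChart_mem_maximalAtlas (φ.map_source hφx)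
  · simp only [hz0, φ.left_inv hφx]
  · have hev := hsm.continuousAt.preimage_mem_nhds (t := φ.target) (by
      rw [hz0]; exact φ.open_target.mem_nhds (φ.map_source hφx))
    filter_upwards [hev, ψ.open_source.mem_nhds hψx] with y hy hyψ
    refine ψ.injOn (hs _ hy) hyψ ?_
    rw [hw _ hy, e.apply_symm_apply]

/-- A smooth function which is constant on the fibres of a surjective submersion descends to a
smooth function. -/
lemma exists_comp_eq_of_isSubmersion {p : M → N}
    (hp : Manifold.IsSubmersion (𝓡 m) (𝓡 d) ∞ p) (hsurj : Function.Surjective p)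
    (g : C^∞⟮𝓡 m, M; ℝ⟯) (hg : ∀ x y, p x = p y → g x = g y) :
    ∃ f : C^∞⟮𝓡 d, N; ℝ⟯, f.comp ⟨p, hp.contMDiff⟩ = g := by
  choose s hs using hsurj
  have hgs : ∀ y, g (s (p y)) = g y := fun y => hg _ _ (hs _)
  refine ⟨⟨fun y => g (s y), fun y => ?_⟩, ContMDiffMap.ext hgs⟩
  obtain ⟨σ, hσ, -, hpσ⟩ := exists_localSection hp (s y)
  rw [hs] at hσ hpσ
  refine (g.contMDiff.contMDiffAt.comp y hσ).congr_of_eventuallyEq ?_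
  filter_upwards [hpσ] with z hz
  exact hg _ _ ((hs z).trans hz.symm)

variable [T2Space M] [IsManifold (𝓡 m) ∞ M] [T2Space N] [IsManifold (𝓡 d) ∞ N]

/-- Pull-back along `p` gives one direction. For the other, `f` agrees near `p x` with the pull-back
of `f ∘ p` along a local section through `x`. -/
lemma comp_mem_flatIdeal_iff {p : M → N} (hp : Manifold.IsSubmersion (𝓡 m) (𝓡 d) ∞ p)
    {X : Set M} (f : C^∞⟮𝓡 d, N; ℝ⟯) :
    f.comp ⟨p, hp.contMDiff⟩ ∈ flatIdeal X ↔ f ∈ flatIdeal (p '' X) := by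
  rw [mem_flatIdeal_iff, mem_flatIdeal_iff, forall_mem_image]
  refine forall₂_congr fun x _ => ⟨fun h => ?_, fun h => ?_⟩
  · obtain ⟨σ, hσ, hσx, hpσ⟩ := exists_localSection hp x
    refine FlatAt.pullback hσ (IsManifold.chart_mem_maximalAtlas _) (mem_chart_source _ _)
      (IsManifold.chart_mem_maximalAtlas x) (by rw [hσx]; exact mem_chart_source _ _) ?_
      (by rwa [hσx])
    filter_upwards [hpσ] with y hy
    exact (congrArg f hy).symm
  · exact FlatAt.pullback (hp.contMDiff x) (IsManifold.chart_mem_maximalAtlas _)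
      (mem_chart_source _ _) (IsManifold.chart_mem_maximalAtlas _) (mem_chart_source _ _)
      (EventuallyEq.refl _ _) h

end Submersion

/-! ### The algebra isomorphism for a given smooth structure on the orbit space. -/

section OrbitProj

variable {G M : Type*} [Group G] [MulAction G M]

lemma orbitProj_surjective : Function.Surjective (orbitProj G M) := Quotient.mk_surjective

lemma orbitProj_eq_iff {x y : M} : orbitProj G M x = orbitProj G M y ↔ ∃ g : G, g • y = x :=
  Quotient.eq

lemma orbitProj_smul (g : G) (x : M) : orbitProj G M (g • x) = orbitProj G M x :=
  orbitProj_eq_iff.2 ⟨g, rfl⟩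

end OrbitProj

section Orbit

variable {m d : ℕ}
  {M : Type*} [TopologicalSpace M] [ChartedSpace (EuclideanSpace ℝ (Fin m)) M]
  {G : Type*} [Group G] [MulAction G M]

variable [ChartedSpace (EuclideanSpace ℝ (Fin d)) (MulAction.orbitRel.Quotient G M)]

/-- Pull-back of functions on the orbit space, followed by the jet map. -/
def jetPullback (hπ : Manifold.IsSubmersion (𝓡 m) (𝓡 d) ∞ (orbitProj G M)) (X : Set M) :
    C^∞⟮𝓡 d, MulAction.orbitRel.Quotient G M; ℝ⟯ →ₐ[ℝ] invariantWhitneyAlgebra m G X where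
  toFun f := ⟨jetMap X (f.comp ⟨orbitProj G M, hπ.contMDiff⟩),
    f.comp ⟨orbitProj G M, hπ.contMDiff⟩, fun g x => congrArg f (orbitProj_smul g x), rfl⟩
  map_one' := rfl
  map_mul' _ _ := rfl
  map_zero' := rfl
  map_add' _ _ := rfl
  commutes' _ := rfl

lemma jetPullback_surjective (hπ : Manifold.IsSubmersion (𝓡 m) (𝓡 d) ∞ (orbitProj G M))
    (X : Set M) : Function.Surjective (jetPullback hπ X) := by
  rintro ⟨_, g, hg, rfl⟩
  obtain ⟨f, hf⟩ := exists_comp_eq_of_isSubmersion hπ orbitProj_surjective g fun x y hxy => by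
    obtain ⟨a, rfl⟩ := orbitProj_eq_iff.1 hxy
    exact hg a y
  exact ⟨f, Subtype.ext (congrArg (jetMap X) hf)⟩

variable [T2Space M] [IsManifold (𝓡 m) ∞ M] [T2Space (MulAction.orbitRel.Quotient G M)]
  [IsManifold (𝓡 d) ∞ (MulAction.orbitRel.Quotient G M)]

lemma jetPullback_eq_zero_iff (hπ : Manifold.IsSubmersion (𝓡 m) (𝓡 d) ∞ (orbitProj G M))
    (X : Set M) (f : C^∞⟮𝓡 d, MulAction.orbitRel.Quotient G M; ℝ⟯) :
    jetPullback hπ X f = 0 ↔ f ∈ flatIdeal (orbitProj G M '' X) := by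
  rw [← comp_mem_flatIdeal_iff hπ, ← Subalgebra.coe_eq_zero]
  exact Ideal.Quotient.eq_zero_iff_mem

lemma exists_whitneyAlgebra_algEquiv
    (hπ : Manifold.IsSubmersion (𝓡 m) (𝓡 d) ∞ (orbitProj G M)) (X : Set M) :
    ∃ e : WhitneyAlgebra d (orbitProj G M '' X) ≃ₐ[ℝ] invariantWhitneyAlgebra m G X,
      ∀ f : C^∞⟮𝓡 d, MulAction.orbitRel.Quotient G M; ℝ⟯,
        (e (jetMap (orbitProj G M '' X) f) : WhitneyAlgebra m X) =
          jetMap X (f.comp ⟨orbitProj G M, hπ.contMDiff⟩) := by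
  refine ⟨AlgEquiv.ofBijective (Ideal.Quotient.liftₐ (flatIdeal (orbitProj G M '' X))
    (jetPullback hπ X) fun f hf => (jetPullback_eq_zero_iff hπ X f).2 hf) ⟨?_, ?_⟩, fun f => rfl⟩
  · refine (injective_iff_map_eq_zero _).2 fun q => ?_
    obtain ⟨f, rfl⟩ := Ideal.Quotient.mk_surjective q
    exact fun hf => Ideal.Quotient.eq_zero_iff_mem.2 ((jetPullback_eq_zero_iff hπ X f).1 hf)
  · intro q
    obtain ⟨f, rfl⟩ := jetPullback_surjective hπ X q
    exact ⟨jetMap _ f, rfl⟩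

end Orbit

/-! ### Topology of the orbit space. -/

section TopologicalQuotient

variable {G M : Type*} [Group G] [MulAction G M] [TopologicalSpace M]

lemma isOpenQuotientMap_orbitProj [ContinuousConstSMul G M] :
    IsOpenQuotientMap (orbitProj G M) :=
  MulAction.isOpenQuotientMap_quotientMk

lemma isClosed_image_orbitProj {X : Set M} (hX : IsClosed X)
    (hGX : ∀ (g : G), ∀ x ∈ X, g • x ∈ X) : IsClosed (orbitProj G M '' X) := by
  refine isClosed_coinduced.2 ?_
  convert hX using 1
  ext x
  refine ⟨?_, fun hx => ⟨x, hx, rfl⟩⟩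
  rintro ⟨y, hy, hxy⟩
  obtain ⟨g, rfl⟩ := orbitProj_eq_iff.1 hxy.symm
  exact hGX g y hy

variable [TopologicalSpace G] [CompactSpace G] [ContinuousSMul G M] [T2Space M]

/-- The quotient map is open, so it suffices that the orbit relation is closed. It is the projection
of the closed set `g • y = x` along the compact factor `G`. -/
lemma t2Space_orbitQuotient : T2Space (MulAction.orbitRel.Quotient G M) := by
  rw [t2Space_iff_of_isOpenQuotientMap (isOpenQuotientMap_orbitProj (G := G) (M := M))]
  have hcl : IsClosed {q : G × (M × M) | q.1 • q.2.2 = q.2.1} :=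
    isClosed_eq (by fun_prop) (by fun_prop)
  convert isClosedMap_snd_of_compactSpace _ hcl using 1
  ext q
  simp [orbitProj_eq_iff]

/-- Each `g` off the interior of `K` moves `x`, hence separates nearby pairs of points; compactness
of that complement makes the neighbourhood uniform in `g`. -/
lemma exists_nhds_forall_smul_mem (hfree : ∀ (g : G) (x : M), g • x = x → g = 1) (x : M)
    {K : Set G} (hK : K ∈ 𝓝 1) : ∃ V ∈ 𝓝 x, ∀ y ∈ V, ∀ g : G, g • y ∈ V → g ∈ K := by
  have hC : IsCompact (interior K)ᶜ := isOpen_interior.isClosed_compl.isCompact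
  have hev : ∀ᶠ q : M × M in 𝓝 (x, x), ∀ g ∈ (interior K)ᶜ, g • q.1 ≠ q.2 := by
    refine hC.eventually_forall_of_forall_eventually fun g hg => ?_
    have hne : g • x ≠ x := fun h => hg (by
      rw [hfree g x h]
      exact mem_interior_iff_mem_nhds.2 hK)
    have ho : IsOpen {z : (M × M) × G | z.2 • z.1.1 ≠ z.1.2} :=
      isOpen_ne_fun (by fun_prop) (by fun_prop)
    exact ho.mem_nhds hne
  rw [nhds_prod_eq] at hev
  obtain ⟨V, hV, h⟩ := (eventually_prod_self_iff
    (r := fun y y' => ∀ g ∈ (interior K)ᶜ, g • y ≠ y')).1 hev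
  refine ⟨V, hV, fun y hy g hg => interior_subset ?_⟩
  by_contra hgK
  exact h y hy _ hg g hgK rfl

end TopologicalQuotient

/-! ### The action in charts and its derivative along the orbit. -/

section OrbitMap

variable {m k : ℕ}
  {M : Type*} [TopologicalSpace M] [ChartedSpace (EuclideanSpace ℝ (Fin m)) M]
  {G : Type*} [Group G] [TopologicalSpace G]
  [ChartedSpace (EuclideanSpace ℝ (Fin k)) G] [MulAction G M]

/-- The action read in the charts at `1 ∈ G` and `x ∈ M`. -/
def chartSMul (G : Type*) [Group G] [TopologicalSpace G]
    [ChartedSpace (EuclideanSpace ℝ (Fin k)) G] [MulAction G M] (x : M)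
    (p : EuclideanSpace ℝ (Fin m) × EuclideanSpace ℝ (Fin k)) : EuclideanSpace ℝ (Fin m) :=
  chartAt (EuclideanSpace ℝ (Fin m)) x ((chartAt (EuclideanSpace ℝ (Fin k)) (1 : G)).symm p.2 •
    (chartAt (EuclideanSpace ℝ (Fin m)) x).symm p.1)

/-- The domain on which `chartSMul` is meaningful. -/
def chartSMulDomain (G : Type*) [Group G] [TopologicalSpace G]
    [ChartedSpace (EuclideanSpace ℝ (Fin k)) G] [MulAction G M] (x : M) :
    Set (EuclideanSpace ℝ (Fin m) × EuclideanSpace ℝ (Fin k)) :=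
  (chartAt (EuclideanSpace ℝ (Fin m)) x).target ×ˢ
      (chartAt (EuclideanSpace ℝ (Fin k)) (1 : G)).target ∩
    (fun p => (chartAt (EuclideanSpace ℝ (Fin k)) (1 : G)).symm p.2 •
      (chartAt (EuclideanSpace ℝ (Fin m)) x).symm p.1) ⁻¹'
        (chartAt (EuclideanSpace ℝ (Fin m)) x).source

lemma mem_chartSMulDomain (x : M) : (chartAt (EuclideanSpace ℝ (Fin m)) x x,
    chartAt (EuclideanSpace ℝ (Fin k)) (1 : G) 1) ∈ chartSMulDomain G x := by
  refine ⟨⟨mem_chart_target _ _, mem_chart_target _ _⟩, ?_⟩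
  simp

lemma chartSMul_one (x : M) : ∀ᶠ y in 𝓝 (chartAt (EuclideanSpace ℝ (Fin m)) x x),
    chartSMul G x (y, chartAt (EuclideanSpace ℝ (Fin k)) (1 : G) 1) = y := by
  filter_upwards [chart_target_mem_nhds _ x] with y hy
  simp [chartSMul, (chartAt _ x).right_inv hy]

variable [LieGroup (𝓡 k) ∞ G] [ContMDiffSMul (𝓡 k) (𝓡 m) ∞ G M] [IsManifold (𝓡 m) ∞ M]

lemma contMDiffOn_smul_charts (x : M) :
    ContMDiffOn 𝓘(ℝ, EuclideanSpace ℝ (Fin m) × EuclideanSpace ℝ (Fin k)) (𝓡 m) ∞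
      (fun p : EuclideanSpace ℝ (Fin m) × EuclideanSpace ℝ (Fin k) =>
        (chartAt (EuclideanSpace ℝ (Fin k)) (1 : G)).symm p.2 •
          (chartAt (EuclideanSpace ℝ (Fin m)) x).symm p.1)
      ((chartAt (EuclideanSpace ℝ (Fin m)) x).target ×ˢ
        (chartAt (EuclideanSpace ℝ (Fin k)) (1 : G)).target) := by
  refine ContMDiffOn.smul (I := 𝓡 k) ?_ ?_
  · exact (contMDiffOn_chart_symm (I := 𝓡 k) (n := ∞)).comp contDiff_snd.contMDiff.contMDiffOn
      fun p hp => hp.2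
  · exact (contMDiffOn_chart_symm (I := 𝓡 m) (n := ∞)).comp contDiff_fst.contMDiff.contMDiffOn
      fun p hp => hp.1

lemma isOpen_chartSMulDomain (x : M) :
    IsOpen (chartSMulDomain (m := m) (k := k) G x) :=
  (contMDiffOn_smul_charts (m := m) (k := k) (G := G) x).continuousOn.isOpen_inter_preimage
    ((chartAt (EuclideanSpace ℝ (Fin m)) x).open_target.prod
      (chartAt (EuclideanSpace ℝ (Fin k)) (1 : G)).open_target)
    (chartAt (EuclideanSpace ℝ (Fin m)) x).open_source

lemma contDiffOn_chartSMul (x : M) :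
    ContDiffOn ℝ ∞ (chartSMul (m := m) (k := k) G x) (chartSMulDomain (m := m) (k := k) G x) := by
  rw [← contMDiffOn_iff_contDiffOn]
  exact (contMDiffOn_chart (I := 𝓡 m) (n := ∞)).comp
    ((contMDiffOn_smul_charts (m := m) (k := k) (G := G) x).mono inter_subset_left) fun p hp => hp.2

/-- The orbit map of a free action has injective derivative at the unit. -/
lemma eq_zero_of_fderiv_chartSMul_eq_zero
    (hfree : ∀ (g : G) (x : M), g • x = x → g = 1) (x : M) {v : EuclideanSpace ℝ (Fin k)}
    (hv : fderiv ℝ (chartSMul G x) (chartAt (EuclideanSpace ℝ (Fin m)) x x,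
      chartAt (EuclideanSpace ℝ (Fin k)) (1 : G) 1) (0, v) = 0) : v = 0 := by
  set φ := chartAt (EuclideanSpace ℝ (Fin m)) x
  set κ := chartAt (EuclideanSpace ℝ (Fin k)) (1 : G)
  set a₀ := κ 1
  have hκ1 : κ.symm a₀ = 1 := κ.left_inv (mem_chart_source _ _)
  have hκt : κ.target ∈ 𝓝 a₀ := chart_target_mem_nhds _ _
  have hφt : φ.target ∈ 𝓝 (φ x) := chart_target_mem_nhds _ _
  have hcs : ContDiffAt ℝ ∞ (chartSMul G x) (φ x, a₀) :=
    (contDiffOn_chartSMul x).contDiffAt ((isOpen_chartSMulDomain x).mem_nhds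
      (mem_chartSMulDomain x))
  have hpair : ContDiffAt ℝ ∞ (fun a : EuclideanSpace ℝ (Fin k) => (φ x, a)) a₀ :=
    contDiffAt_const.prodMk contDiffAt_id
  have hκs : ContMDiffAt (𝓡 k) (𝓡 k) ∞ κ.symm a₀ :=
    contMDiffAt_symm_of_mem_maximalAtlas (IsManifold.chart_mem_maximalAtlas _)
      (mem_chart_target _ _)
  have hmul : ContMDiffAt 𝓘(ℝ, EuclideanSpace ℝ (Fin k) × EuclideanSpace ℝ (Fin k)) (𝓡 k) ∞
      (fun p : EuclideanSpace ℝ (Fin k) × EuclideanSpace ℝ (Fin k) => κ.symm p.1 * κ.symm p.2)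
      (a₀, a₀) :=
    (ContMDiffAt.comp (g := κ.symm) (f := Prod.fst) (a₀, a₀) hκs
      contDiff_fst.contMDiff.contMDiffAt).mul
    (ContMDiffAt.comp (g := κ.symm) (f := Prod.snd) (a₀, a₀) hκs
      contDiff_snd.contMDiff.contMDiffAt)
  have hμ : ContDiffAt ℝ ∞ (fun p : EuclideanSpace ℝ (Fin k) × EuclideanSpace ℝ (Fin k) =>
      κ (κ.symm p.1 * κ.symm p.2)) (a₀, a₀) := by
    rw [← contMDiffAt_iff_contDiffAt]
    refine ContMDiffAt.comp (g := κ) (a₀, a₀) ?_ hmul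
    simp only [hκ1, mul_one]
    exact contMDiffAt_of_mem_maximalAtlas (IsManifold.chart_mem_maximalAtlas _)
      (mem_chart_source _ _)
  have hsmx : ContMDiff (𝓡 k) (𝓡 m) ∞ fun g : G => g • x :=
    contMDiff_id.smul (I := 𝓡 k) contMDiff_const
  have hφx : φ.symm (φ x) = x := φ.left_inv (mem_chart_source _ _)
  have horb : ∀ᶠ a in 𝓝 a₀, κ.symm a • x ∈ φ.source := by
    refine (hsmx.continuous.continuousAt.comp hκs.continuousAt).preimage_mem_nhds
      (t := φ.source) ?_
    simp only [Function.comp_apply, hκ1, one_smul]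
    exact chart_source_mem_nhds _ _
  refine eq_zero_of_fderiv_orbitMap_eq_zero (μ := fun p => κ (κ.symm p.1 * κ.symm p.2))
    (f := fun a => chartSMul G x (φ x, a)) (a₀ := a₀) (hμ.of_le ENat.LEInfty.out)
    ((hcs.comp a₀ hpair).of_le (by simp)) ?_ ?_ ?_ ?_ ?_
  · filter_upwards [hκt] with a ha
    simp [hκ1, κ.right_inv ha]
  · filter_upwards [hκt] with a ha
    simp [hκ1, κ.right_inv ha]
  · have hdom : ∀ᶠ a in 𝓝 a₀, (φ x, a) ∈ chartSMulDomain G x :=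
      hpair.continuousAt.preimage_mem_nhds
        ((isOpen_chartSMulDomain x).mem_nhds (mem_chartSMulDomain x))
    have hmulev : ∀ᶠ a in 𝓝 a₀, κ.symm a * κ.symm a₀ ∈ κ.source := by
      filter_upwards [hκt] with a ha
      rw [hκ1, mul_one]
      exact κ.map_target ha
    filter_upwards [hdom, hκt] with a ha haκ
    -- Equivariance of the orbit map: left translation by `a` on the group corresponds to the action
    -- of `a` on `M`.
    refine ⟨fun e => chartSMul G x (e, a), ?_, ?_⟩
    · have h0 : chartSMul G x (φ x, a₀) = φ x := by
        simp only [chartSMul, a₀, κ, φ] at *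
        simp
      rw [h0]
      exact (((contDiffOn_chartSMul x).contDiffAt
        ((isOpen_chartSMulDomain x).mem_nhds ha)).comp (φ x)
        (contDiffAt_id.prodMk contDiffAt_const)).differentiableAt (by simp)
    · have hs : ∀ᶠ b in 𝓝 a₀, κ.symm a * κ.symm b ∈ κ.source := by
        have hc : ContMDiffAt (𝓡 k) (𝓡 k) ∞ (fun b => κ.symm a * κ.symm b) a₀ :=
          contMDiffAt_const.mul hκs
        refine hc.continuousAt.preimage_mem_nhds (t := κ.source) (κ.open_source.mem_nhds ?_)
        rw [hκ1, mul_one]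
        exact κ.map_target haκ
      filter_upwards [hs, horb] with b hb hbx
      change φ (κ.symm (κ (κ.symm a * κ.symm b)) • φ.symm (φ x)) =
        φ (κ.symm a • φ.symm (φ (κ.symm b • φ.symm (φ x))))
      rw [κ.left_inv hb, hφx, φ.left_inv hbx, mul_smul]
  · filter_upwards [horb, hκt] with a ha haκ h
    have h' : φ (κ.symm a • φ.symm (φ x)) = φ (κ.symm a₀ • φ.symm (φ x)) := h
    rw [hφx, hκ1, one_smul] at h'
    have h1 := hfree _ _ (φ.injOn ha (mem_chart_source _ _) h')
    rw [← κ.right_inv haκ, h1]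
  · have := (hcs.differentiableAt (by simp)).hasFDerivAt.comp a₀
      (hasFDerivAt_prodMk_right (φ x) a₀)
    have h2 : fderiv ℝ (fun a => chartSMul G x (φ x, a)) a₀ = _ := this.fderiv
    rw [h2]
    simpa using hv

end OrbitMap

/-! ### Transversals and slice coordinates. -/

section Slice

variable {m k : ℕ}
  {M : Type*} [TopologicalSpace M] [ChartedSpace (EuclideanSpace ℝ (Fin m)) M]
  {G : Type*} [Group G] [TopologicalSpace G]
  [ChartedSpace (EuclideanSpace ℝ (Fin k)) G] [MulAction G M]
  [LieGroup (𝓡 k) ∞ G] [ContMDiffSMul (𝓡 k) (𝓡 m) ∞ G M] [IsManifold (𝓡 m) ∞ M]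

/-- The derivative of `chartSMul` at the base point. -/
def chartSMulDeriv (G : Type*) [Group G] [TopologicalSpace G]
    [ChartedSpace (EuclideanSpace ℝ (Fin k)) G] [MulAction G M] (x : M) :
    EuclideanSpace ℝ (Fin m) × EuclideanSpace ℝ (Fin k) →L[ℝ] EuclideanSpace ℝ (Fin m) :=
  fderiv ℝ (chartSMul G x) (chartAt (EuclideanSpace ℝ (Fin m)) x x,
    chartAt (EuclideanSpace ℝ (Fin k)) (1 : G) 1)

lemma hasFDerivAt_chartSMul (x : M) : HasFDerivAt (chartSMul (m := m) (k := k) G x)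
    (chartSMulDeriv G x) (chartAt (EuclideanSpace ℝ (Fin m)) x x,
      chartAt (EuclideanSpace ℝ (Fin k)) (1 : G) 1) :=
  (((contDiffOn_chartSMul x).contDiffAt ((isOpen_chartSMulDomain x).mem_nhds
    (mem_chartSMulDomain x))).differentiableAt (by simp)).hasFDerivAt

lemma chartSMulDeriv_inl (x : M) (e : EuclideanSpace ℝ (Fin m)) :
    chartSMulDeriv (m := m) (k := k) G x (e, 0) = e := by
  have h1 := (hasFDerivAt_chartSMul (m := m) (k := k) (G := G) x).comp
    (chartAt (EuclideanSpace ℝ (Fin m)) x x) (f := fun y => (y, _)) (hasFDerivAt_prodMk_left (𝕜 := ℝ) (chartAt (EuclideanSpace ℝ (Fin m)) x x)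
      (chartAt (EuclideanSpace ℝ (Fin k)) (1 : G) 1))
  have h2 := h1.unique ((hasFDerivAt_id _).congr_of_eventuallyEq
    (chartSMul_one (k := k) (G := G) x))
  simpa using congrArg (fun L => L e) h2

lemma chartSMulDeriv_inr_injective (hfree : ∀ (g : G) (x : M), g • x = x → g = 1) (x : M) :
    Function.Injective ((chartSMulDeriv (m := m) (k := k) G x).toLinearMap ∘ₗ
      LinearMap.inr ℝ _ _) := by
  refine (injective_iff_map_eq_zero _).2 fun v hv => ?_
  exact eq_zero_of_fderiv_chartSMul_eq_zero hfree x hv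

lemma le_of_free_action (hfree : ∀ (g : G) (x : M), g • x = x → g = 1) (x : M) : k ≤ m := by
  simpa using LinearMap.finrank_le_finrank_of_injective
    (chartSMulDeriv_inr_injective (m := m) (k := k) hfree x)

/-- A linear complement of the tangent space of the orbit. -/
lemma exists_complement (hfree : ∀ (g : G) (x : M), g • x = x → g = 1) (x : M) :
    ∃ (B : EuclideanSpace ℝ (Fin (m - k)) →L[ℝ] EuclideanSpace ℝ (Fin m))
      (e : (EuclideanSpace ℝ (Fin (m - k)) × EuclideanSpace ℝ (Fin k)) ≃L[ℝ]
        EuclideanSpace ℝ (Fin m)),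
      (e : (EuclideanSpace ℝ (Fin (m - k)) × EuclideanSpace ℝ (Fin k)) →L[ℝ]
        EuclideanSpace ℝ (Fin m)) = (chartSMulDeriv G x).comp (B.prodMap (ContinuousLinearMap.id ℝ _)) := by
  set A : EuclideanSpace ℝ (Fin k) →ₗ[ℝ] EuclideanSpace ℝ (Fin m) :=
    (chartSMulDeriv (m := m) (k := k) G x).toLinearMap ∘ₗ LinearMap.inr ℝ _ _ with hA
  have hAi : Function.Injective A := chartSMulDeriv_inr_injective hfree x
  have hkm : k ≤ m := le_of_free_action (m := m) (k := k) hfree x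
  have hr : Module.finrank ℝ (LinearMap.range A) = k := by
    rw [LinearMap.finrank_range_of_inj hAi, finrank_euclideanSpace_fin]
  have hW : Module.finrank ℝ (LinearMap.range A)ᗮ = m - k := by
    have := (LinearMap.range A).finrank_add_finrank_orthogonal
    rw [finrank_euclideanSpace_fin, hr] at this
    omega
  let L : EuclideanSpace ℝ (Fin (m - k)) ≃L[ℝ] (LinearMap.range A)ᗮ :=
    ContinuousLinearEquiv.ofFinrankEq (by rw [hW, finrank_euclideanSpace_fin])
  let B : EuclideanSpace ℝ (Fin (m - k)) →L[ℝ] EuclideanSpace ℝ (Fin m) :=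
    (LinearMap.range A)ᗮ.subtypeL.comp L.toContinuousLinearMap
  let T := (chartSMulDeriv (m := m) (k := k) G x).comp (B.prodMap (ContinuousLinearMap.id ℝ _))
  -- The unit acts trivially, so the derivative is the identity on the `M`-directions.
  have hT : ∀ p, T p = B p.1 + A p.2 := fun p => by
    have : (B p.1, p.2) = (B p.1, 0) + (0, p.2) := by simp
    change chartSMulDeriv G x (B p.1, p.2) = B p.1 + chartSMulDeriv G x (0, p.2)
    rw [this, map_add, chartSMulDeriv_inl]
  have hTi : Function.Injective T.toLinearMap := by
    refine (injective_iff_map_eq_zero _).2 fun p hp => ?_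
    have hp' : B p.1 + A p.2 = 0 := (hT p).symm.trans hp
    have hmem : B p.1 ∈ LinearMap.range A := by
      rw [eq_neg_of_add_eq_zero_left hp']
      exact neg_mem (LinearMap.mem_range_self _ _)
    have hB : B p.1 = 0 := by
      rw [← Submodule.mem_bot ℝ, ← (LinearMap.range A).inf_orthogonal_eq_bot]
      exact ⟨hmem, (L p.1).2⟩
    rw [hB, zero_add] at hp'
    have h2 : p.2 = 0 := hAi (hp'.trans (map_zero A).symm)
    have h1 : p.1 = 0 := L.injective (Subtype.ext (hB.trans (by simp)))
    exact Prod.ext h1 h2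
  refine ⟨B, (LinearEquiv.ofInjectiveOfFinrankEq T.toLinearMap hTi ?_).toContinuousLinearEquiv,
    ?_⟩
  · simp
    omega
  · ext p <;> rfl

variable [CompactSpace G] [T2Space M]

/-- Around every point there are smooth coordinates `(w, a)` in which the orbits are the slices
`w = const`. -/
lemma exists_sliceChart (hfree : ∀ (g : G) (x : M), g • x = x → g = 1) (x : M) :
    ∃ (q : OpenPartialHomeomorph M
        (EuclideanSpace ℝ (Fin (m - k)) × EuclideanSpace ℝ (Fin k)))
      (a₀ : EuclideanSpace ℝ (Fin k)), x ∈ q.source ∧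
      ContMDiffOn (𝓡 m) 𝓘(ℝ, EuclideanSpace ℝ (Fin (m - k)) × EuclideanSpace ℝ (Fin k)) ∞
        q q.source ∧
      ContMDiffOn 𝓘(ℝ, EuclideanSpace ℝ (Fin (m - k)) × EuclideanSpace ℝ (Fin k)) (𝓡 m) ∞
        q.symm q.target ∧
      (∀ p ∈ q.target, (p.1, a₀) ∈ q.target) ∧
      ∀ y ∈ q.source, ∀ y' ∈ q.source,
        (orbitProj G M y = orbitProj G M y' ↔ (q y).1 = (q y').1) := by
  have : ContinuousSMul G M := ContMDiffSMul.continuousSMul (I := 𝓡 k) (I' := 𝓡 m) ∞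
  obtain ⟨B, e, he⟩ := exists_complement (m := m) (k := k) hfree x
  have hD := hasFDerivAt_chartSMul (m := m) (k := k) (G := G) x
  have hDom := mem_chartSMulDomain (m := m) (k := k) (G := G) x
  have hDo := isOpen_chartSMulDomain (m := m) (k := k) (G := G) x
  have hDs := contDiffOn_chartSMul (m := m) (k := k) (G := G) x
  set φ := chartAt (EuclideanSpace ℝ (Fin m)) x
  set κ := chartAt (EuclideanSpace ℝ (Fin k)) (1 : G)
  set a₀ := κ 1
  set c := φ x
  have hκ1 : κ.symm a₀ = 1 := κ.left_inv (mem_chart_source _ _)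
  -- The transversal is the affine subspace `c + B w` of the chart, moved around by the group
  -- coordinate.
  let J : EuclideanSpace ℝ (Fin (m - k)) × EuclideanSpace ℝ (Fin k) →
    EuclideanSpace ℝ (Fin m) × EuclideanSpace ℝ (Fin k) := fun p => (c + B p.1, p.2)
  have hJ : ContDiff ℝ ∞ J := by fun_prop
  have hJ0 : J (0, a₀) = (c, a₀) := by simp [J]
  have hJ' : HasFDerivAt J (B.prodMap (ContinuousLinearMap.id ℝ _)) (0, a₀) :=
    ((B.hasFDerivAt.comp _ hasFDerivAt_fst).const_add c).prodMk hasFDerivAt_snd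
  obtain ⟨Ψ, hΨ0, hΨO, hΨF, hΨs⟩ := exists_openPartialHomeomorph_of_contDiffOn
    (f := chartSMul G x ∘ J) (O := J ⁻¹' chartSMulDomain G x)
    (hDo.preimage hJ.continuous) (hDs.comp hJ.contDiffOn fun p hp => hp) (x := (0, a₀))
    (by rw [mem_preimage, hJ0]; exact hDom) (f' := e) (by
      rw [he]
      refine HasFDerivAt.comp (g := chartSMul G x) _ ?_ hJ'
      rwa [hJ0])
  obtain ⟨U₁, U₂, hU₁, h0U₁, hU₂, haU₂, hUΨ⟩ :=
    mem_nhds_prod_iff'.1 (Ψ.open_source.mem_nhds hΨ0)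
  have hK : κ.source ∩ κ ⁻¹' U₂ ∈ 𝓝 (1 : G) :=
    inter_mem (chart_source_mem_nhds _ _)
      ((κ.continuousAt (mem_chart_source _ _)).preimage_mem_nhds (hU₂.mem_nhds haU₂))
  obtain ⟨V, hV, hVK⟩ := exists_nhds_forall_smul_mem hfree x hK
  let s : EuclideanSpace ℝ (Fin (m - k)) → M := fun w => φ.symm (c + B w)
  have hs0 : s 0 = x := by simp [s, c, φ]
  have hsc : ContinuousAt s 0 := by
    refine ContinuousAt.comp (g := φ.symm) ?_ (by fun_prop)
    simpa using φ.continuousAt_symm (mem_chart_target _ x)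
  -- Shrinking keeps `s w` in `V`: a group element relating two points of the transversal then has
  -- coordinates in `U₂`.
  obtain ⟨U, hUsub, hU, h0U⟩ := mem_nhds_iff.1 (inter_mem (hU₁.mem_nhds h0U₁)
    (hsc.preimage_mem_nhds (by rwa [hs0])))
  have hbox : ∀ p ∈ U ×ˢ U₂, p ∈ Ψ.source := fun p hp => hUΨ ⟨(hUsub hp.1).1, hp.2⟩
  have hΨφ : ∀ p ∈ Ψ.source, φ.symm (Ψ p) = κ.symm p.2 • s p.1 := fun p hp => by
    rw [hΨF]
    exact φ.left_inv (hΨO hp).2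
  have hΨt : ∀ p ∈ Ψ.source, Ψ p ∈ φ.target := fun p hp => by
    rw [hΨF]
    exact φ.map_source (hΨO hp).2
  let Θ := Ψ.restrOpen (U ×ˢ U₂) (hU.prod hU₂)
  have hΘs : Θ.source = U ×ˢ U₂ := by
    change Ψ.source ∩ U ×ˢ U₂ = U ×ˢ U₂
    exact inter_eq_right.2 hbox
  let q := φ.trans Θ.symm
  have hqt : q.target = U ×ˢ U₂ := by
    change Θ.source ∩ Θ ⁻¹' φ.target = _
    rw [hΘs]
    exact inter_eq_left.2 fun p hp => hΨt p (hbox p hp)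
  have hqsymm : ∀ p ∈ q.target, q.symm p = κ.symm p.2 • s p.1 := fun p hp => by
    rw [hqt] at hp
    exact hΨφ p (hbox p hp)
  have hproj : ∀ y ∈ q.source, orbitProj G M y = orbitProj G M (s (q y).1) := fun y hy => by
    conv_lhs => rw [← q.left_inv hy, hqsymm _ (q.map_source hy)]
    exact orbitProj_smul _ _
  refine ⟨q, a₀, ?_, ?_, ?_, ?_, fun y hy y' hy' => ⟨fun h => ?_, fun h => ?_⟩⟩
  · have hmem : ((0 : EuclideanSpace ℝ (Fin (m - k))), a₀) ∈ q.target := by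
      rw [hqt]
      exact ⟨h0U, haU₂⟩
    have := q.map_target hmem
    rwa [hqsymm _ hmem, hκ1, one_smul, hs0] at this
  · refine ContMDiffOn.comp (t := Θ.target) ?_
      ((contMDiffOn_chart (I := 𝓡 m) (n := ∞)).mono inter_subset_left) fun y hy => hy.2
    exact (hΨs.mono inter_subset_left).contMDiffOn
  · refine ContMDiffOn.comp (t := φ.target) (contMDiffOn_chart_symm (I := 𝓡 m) (n := ∞)) ?_
      fun p hp => hp.2
    rw [hqt]
    refine ContDiffOn.contMDiffOn ?_
    change ContDiffOn ℝ ∞ Ψ _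
    rw [hΨF]
    exact hDs.comp hJ.contDiffOn fun p hp => hΨO (hbox p hp)
  · intro p hp
    rw [hqt] at hp ⊢
    exact ⟨hp.1, haU₂⟩
  · rw [hproj y hy, hproj y' hy', orbitProj_eq_iff] at h
    obtain ⟨g, hg⟩ := h
    have hy1 := q.map_source hy
    have hy1' := q.map_source hy'
    rw [hqt] at hy1 hy1'
    obtain ⟨hgs, hgU⟩ := hVK _ (hUsub hy1'.1).2 g (by rw [hg]; exact (hUsub hy1.1).2)
    have hp : ((q y').1, κ g) ∈ Ψ.source := hbox _ ⟨hy1'.1, hgU⟩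
    have hp' : ((q y).1, a₀) ∈ Ψ.source := hbox _ ⟨hy1.1, haU₂⟩
    -- The relation `g • s w' = s w` says that `(w', κ g)` and `(w, a₀)` have the same image;
    -- injectivity of `Ψ` on the box gives `w' = w`.
    have heq : Ψ ((q y').1, κ g) = Ψ ((q y).1, a₀) := by
      refine φ.symm.injOn (hΨt _ hp) (hΨt _ hp') ?_
      rw [hΨφ _ hp, hΨφ _ hp', hκ1, one_smul, κ.left_inv hgs, hg]
    exact (congrArg Prod.fst (Ψ.injOn hp hp' heq)).symm
  · rw [hproj y hy, hproj y' hy', h]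

end Slice

/-! ### The smooth structure on the orbit space. -/

section QuotientChart

variable {m d : ℕ} {M : Type*} [TopologicalSpace M] [ChartedSpace (EuclideanSpace ℝ (Fin m)) M]
  {N : Type*} [TopologicalSpace N]

/-- The charts of `N` for which `p : M → N` is smooth and has smooth sections. -/
def quotientAtlas (m d : ℕ) {M : Type*} [TopologicalSpace M]
    [ChartedSpace (EuclideanSpace ℝ (Fin m)) M] (p : M → N) :
    Set (OpenPartialHomeomorph N (EuclideanSpace ℝ (Fin d))) :=
  {ψ | ContMDiffOn (𝓡 m) (𝓡 d) ∞ (ψ ∘ p) (p ⁻¹' ψ.source) ∧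
    ∃ σ : EuclideanSpace ℝ (Fin d) → M, ContMDiffOn (𝓡 d) (𝓡 m) ∞ σ ψ.target ∧
      ∀ w ∈ ψ.target, p (σ w) = ψ.symm w}

/-- The charted space structure with atlas `quotientAtlas`. -/
@[reducible]
def quotientChartedSpace {p : M → N} (h : ∀ y, ∃ ψ ∈ quotientAtlas m d p, y ∈ ψ.source) :
    ChartedSpace (EuclideanSpace ℝ (Fin d)) N where
  atlas := quotientAtlas m d p
  chartAt y := (h y).choose
  mem_chart_source y := (h y).choose_spec.2
  chart_mem_atlas y := (h y).choose_spec.1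

/-- A transition map is `(ψ' ∘ p) ∘ σ` with `σ` the section belonging to `ψ`, a composite of smooth
maps. -/
lemma isManifold_quotientChartedSpace {p : M → N}
    (h : ∀ y, ∃ ψ ∈ quotientAtlas m d p, y ∈ ψ.source) :
    letI := quotientChartedSpace h
    IsManifold (𝓡 d) ∞ N := by
  let _ := quotientChartedSpace h
  refine isManifold_of_contDiffOn _ _ _ fun ψ ψ' hψ hψ' => ?_
  obtain ⟨-, σ, hσ, hpσ⟩ := hψ
  obtain ⟨hψ', -⟩ := hψ'
  have hsub : ∀ w ∈ (ψ.symm.trans ψ').source, w ∈ ψ.target ∧ p (σ w) ∈ ψ'.source := fun w hw => by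
    rw [hpσ w hw.1]
    exact hw
  have key : ContDiffOn ℝ ∞ ((ψ' ∘ p) ∘ σ) (ψ.symm.trans ψ').source := by
    rw [← contMDiffOn_iff_contDiffOn]
    exact hψ'.comp (hσ.mono fun w hw => (hsub w hw).1) fun w hw => (hsub w hw).2
  have hset : (𝓡 d).symm ⁻¹' (ψ.symm.trans ψ').source ∩ range (𝓡 d) =
      (ψ.symm.trans ψ').source := by simp
  rw [hset]
  refine key.congr fun w hw => ?_
  simp [hpσ w (hsub w hw).1]

end QuotientChart

section OrbitManifold

variable {m k : ℕ}
  {M : Type*} [TopologicalSpace M] [ChartedSpace (EuclideanSpace ℝ (Fin m)) M]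
  {G : Type*} [Group G] [TopologicalSpace G]
  [ChartedSpace (EuclideanSpace ℝ (Fin k)) G] [MulAction G M]
  [LieGroup (𝓡 k) ∞ G] [ContMDiffSMul (𝓡 k) (𝓡 m) ∞ G M] [IsManifold (𝓡 m) ∞ M]
  [CompactSpace G] [T2Space M]

/-- Around every point there are smooth coordinates `q` of `M` and a chart of the orbit space in
which the projection is `(w, a) ↦ w`. -/
lemma exists_quotientChart (hfree : ∀ (g : G) (x : M), g • x = x → g = 1) (x : M) :
    ∃ (q : OpenPartialHomeomorph M
        (EuclideanSpace ℝ (Fin (m - k)) × EuclideanSpace ℝ (Fin k)))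
      (ψ : OpenPartialHomeomorph (MulAction.orbitRel.Quotient G M)
        (EuclideanSpace ℝ (Fin (m - k)))), x ∈ q.source ∧
      ContMDiffOn (𝓡 m) 𝓘(ℝ, EuclideanSpace ℝ (Fin (m - k)) × EuclideanSpace ℝ (Fin k)) ∞
        q q.source ∧
      ContMDiffOn 𝓘(ℝ, EuclideanSpace ℝ (Fin (m - k)) × EuclideanSpace ℝ (Fin k)) (𝓡 m) ∞
        q.symm q.target ∧
      ψ ∈ quotientAtlas m (m - k) (orbitProj G M) ∧
      ∀ y ∈ q.source, orbitProj G M y ∈ ψ.source ∧ ψ (orbitProj G M y) = (q y).1 := by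
  have : ContinuousSMul G M := ContMDiffSMul.continuousSMul (I := 𝓡 k) (I' := 𝓡 m) ∞
  have hπ := isOpenQuotientMap_orbitProj (G := G) (M := M)
  obtain ⟨q, a₀, hx, hq, hqs, ha₀, hfib⟩ := exists_sliceChart (m := m) (k := k) hfree x
  let U : Set (EuclideanSpace ℝ (Fin (m - k))) := {w | (w, a₀) ∈ q.target}
  have hU : IsOpen U := q.open_target.preimage (by fun_prop)
  let s : EuclideanSpace ℝ (Fin (m - k)) → M := fun w => q.symm (w, a₀)
  have hsq : ∀ w ∈ U, s w ∈ q.source := fun w hw => q.map_target hw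
  have hqs1 : ∀ w ∈ U, (q (s w)).1 = w := fun w hw => congrArg Prod.fst (q.right_inv hw)
  have hqU : ∀ y ∈ q.source, (q y).1 ∈ U := fun y hy => ha₀ _ (q.map_source hy)
  have hproj : ∀ y ∈ q.source, orbitProj G M (s (q y).1) = orbitProj G M y := fun y hy =>
    (hfib _ (hsq _ (hqU y hy)) _ hy).2 (hqs1 _ (hqU y hy))
  have hs : ContMDiffOn (𝓡 (m - k)) (𝓡 m) ∞ s U :=
    hqs.comp (contDiff_id.prodMk contDiff_const).contMDiff.contMDiffOn fun w hw => hw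
  have hinj : InjOn (orbitProj G M ∘ s) U := fun w hw w' hw' h => by
    rw [← hqs1 w hw, ← hqs1 w' hw']
    exact (hfib _ (hsq w hw) _ (hsq w' hw')).1 h
  -- The inverse chart `w ↦ π (s w)` is open: the image of `U ∩ T'` equals the image under the open
  -- map `π` of all points of `q.source` with first coordinate in `T'`.
  let e := OpenPartialHomeomorph.ofContinuousOpenRestrict (hinj.toPartialEquiv _ _)
    (hπ.continuous.comp_continuousOn hs.continuousOn) (by
      intro T hT
      obtain ⟨T', hT', rfl⟩ := isOpen_induced_iff.1 hT
      have ho : IsOpen (q.source ∩ q ⁻¹' (Prod.fst ⁻¹' T')) :=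
        q.isOpen_inter_preimage (hT'.preimage continuous_fst)
      convert hπ.isOpenMap _ ho using 1
      ext z
      constructor
      · rintro ⟨⟨w, hw⟩, hwT, rfl⟩
        exact ⟨s w, ⟨hsq w hw, by
          change (q (s w)).1 ∈ T'
          rw [hqs1 w hw]
          exact hwT⟩, rfl⟩
      · rintro ⟨y, ⟨hy, hyT⟩, rfl⟩
        exact ⟨⟨(q y).1, hqU y hy⟩, hyT, hproj y hy⟩) hU
  have hψq : ∀ y ∈ q.source, orbitProj G M y ∈ e.target ∧
      e.symm (orbitProj G M y) = (q y).1 := fun y hy => by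
    have h1 : e (q y).1 = orbitProj G M y := hproj y hy
    rw [← h1]
    exact ⟨e.map_source (hqU y hy), e.left_inv (hqU y hy)⟩
  refine ⟨q, e.symm, hx, hq, hqs, ⟨fun y hy => ContMDiffAt.contMDiffWithinAt ?_, s, hs,
    fun w _ => rfl⟩, hψq⟩
  -- `q.source` need not be invariant, so `y` is first moved into it by some `g`; near `y` the chart
  -- then reads `z ↦ (q (g • z)).1`.
  obtain ⟨g, hg⟩ : ∃ g : G, g • y ∈ q.source := by
    have h1 : orbitProj G M (s (e.symm (orbitProj G M y))) = orbitProj G M y := e.right_inv hy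
    obtain ⟨g, hg⟩ := orbitProj_eq_iff.1 h1
    exact ⟨g, by rw [hg]; exact hsq _ (e.map_target hy)⟩
  have hsm : ContMDiff (𝓡 m) (𝓡 m) ∞ fun z : M => g • z :=
    ContMDiffSMul.contMDiff_const_smul (I := 𝓡 k) g
  have hloc : ContMDiffAt (𝓡 m) (𝓡 (m - k)) ∞ (fun z => (q (g • z)).1) y :=
    contDiff_fst.contMDiff.contMDiffAt.comp y
      (ContMDiffAt.comp (g := q) y (hq.contMDiffAt (q.open_source.mem_nhds hg)) hsm.contMDiffAt)
  refine hloc.congr_of_eventuallyEq ?_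
  filter_upwards [hsm.continuous.continuousAt.preimage_mem_nhds (q.open_source.mem_nhds hg)]
    with z hz
  rw [← (hψq _ hz).2, orbitProj_smul]
  rfl

/-- The orbit space of a free smooth action of a compact Lie group is a smooth manifold for which
the projection is a submersion. -/
lemma exists_isManifold_orbitQuotient (hfree : ∀ (g : G) (x : M), g • x = x → g = 1) :
    ∃ _ : ChartedSpace (EuclideanSpace ℝ (Fin (m - k))) (MulAction.orbitRel.Quotient G M),
      IsManifold (𝓡 (m - k)) ∞ (MulAction.orbitRel.Quotient G M) ∧
      Manifold.IsSubmersion (𝓡 m) (𝓡 (m - k)) ∞ (orbitProj G M) := by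
  have : ContinuousSMul G M := ContMDiffSMul.continuousSMul (I := 𝓡 k) (I' := 𝓡 m) ∞
  have hcover : ∀ y, ∃ ψ ∈ quotientAtlas m (m - k) (orbitProj G M), y ∈ ψ.source := fun y => by
    obtain ⟨x, rfl⟩ := orbitProj_surjective y
    obtain ⟨q, ψ, hx, -, -, hψ, hqψ⟩ := exists_quotientChart (m := m) (k := k) hfree x
    exact ⟨ψ, hψ, (hqψ x hx).1⟩
  let _ := quotientChartedSpace hcover
  have hman : IsManifold (𝓡 (m - k)) ∞ (MulAction.orbitRel.Quotient G M) :=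
    isManifold_quotientChartedSpace hcover
  refine ⟨_, hman, EuclideanSpace ℝ (Fin k), inferInstance, inferInstance, fun x => ?_⟩
  have hkm : k ≤ m := le_of_free_action (m := m) (k := k) hfree x
  obtain ⟨q, ψ, hx, hq, hqs, hψ, hqψ⟩ := exists_quotientChart (m := m) (k := k) hfree x
  let e : EuclideanSpace ℝ (Fin m) ≃L[ℝ]
      EuclideanSpace ℝ (Fin (m - k)) × EuclideanSpace ℝ (Fin k) :=
    ContinuousLinearEquiv.ofFinrankEq (by simp; omega)
  let φ := q.transHomeomorph e.symm.toHomeomorph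
  have hφ : φ ∈ IsManifold.maximalAtlas (𝓡 m) ∞ M := by
    refine φ.mem_maximalAtlas_of_contMDiffOn ?_ ?_
    · exact e.symm.contDiff.contMDiff.comp_contMDiffOn hq
    · exact hqs.comp e.contDiff.contMDiff.contMDiffOn fun z hz => hz
  refine Manifold.IsSubmersionAtOfComplement.mk_of_charts e φ ψ hx (hqψ x hx).1 hφ
    (IsManifold.subset_maximalAtlas hψ) (fun y hy => (hqψ y hy).1) fun z hz => ?_
  have hz' : e z ∈ q.target := by
    have : z ∈ φ.target := by simpa using hz
    exact this
  have h := (hqψ _ (q.map_target hz')).2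
  rw [q.right_inv hz'] at h
  have hφs : φ.symm z = q.symm (e z) := rfl
  simpa [hφs] using h

end OrbitManifold

end WhitneyFunction

end

open WhitneyFunction in
theorem mainTheorem3 {m k : ℕ}
    {M : Type*} [TopologicalSpace M] [T2Space M] [SecondCountableTopology M]
    [ChartedSpace (EuclideanSpace ℝ (Fin m)) M] [IsManifold (𝓡 m) ∞ M]
    {G : Type*} [Group G] [TopologicalSpace G] [CompactSpace G]
    [ChartedSpace (EuclideanSpace ℝ (Fin k)) G] [LieGroup (𝓡 k) ∞ G]
    [MulAction G M] [ContMDiffSMul (𝓡 k) (𝓡 m) ∞ G M]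
    (hfree : ∀ (g : G) (x : M), g • x = x → g = 1)
    (X : Set M) (hX : IsClosed X) (hGX : ∀ (g : G), ∀ x ∈ X, g • x ∈ X) :
    -- the orbit space is a smooth manifold (of dimension `m - k`) such that the projection is a
    -- smooth submersion, and `Y = X / G` is closed in it
    T2Space (MulAction.orbitRel.Quotient G M) ∧
    SecondCountableTopology (MulAction.orbitRel.Quotient G M) ∧
    (∃ _ : ChartedSpace (EuclideanSpace ℝ (Fin (m - k))) (MulAction.orbitRel.Quotient G M),
      IsManifold (𝓡 (m - k)) ∞ (MulAction.orbitRel.Quotient G M) ∧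
      Manifold.IsSubmersion (𝓡 m) (𝓡 (m - k)) ∞ (orbitProj G M)) ∧
    IsClosed (orbitProj G M '' X) ∧
    -- for this smooth structure, pull-back along the projection is well defined on Whitney
    -- functions and is an isomorphism of algebras `E^∞(Y; N) ≃ E^∞(X; M)^G`
    ∀ (d : ℕ) [ChartedSpace (EuclideanSpace ℝ (Fin d)) (MulAction.orbitRel.Quotient G M)]
      [IsManifold (𝓡 d) ∞ (MulAction.orbitRel.Quotient G M)]
      (hπ : Manifold.IsSubmersion (𝓡 m) (𝓡 d) ∞ (orbitProj G M)),
      ∃ e : WhitneyAlgebra d (orbitProj G M '' X) ≃ₐ[ℝ] invariantWhitneyAlgebra m G X,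
        ∀ f : C^∞⟮𝓡 d, MulAction.orbitRel.Quotient G M; ℝ⟯,
          (e (jetMap (orbitProj G M '' X) f) : WhitneyAlgebra m X) =
            jetMap X (f.comp ⟨orbitProj G M, hπ.contMDiff⟩) := by
  have : ContinuousSMul G M := ContMDiffSMul.continuousSMul (I := 𝓡 k) (I' := 𝓡 m) ∞
  have hT2 : T2Space (MulAction.orbitRel.Quotient G M) := t2Space_orbitQuotient
  exact ⟨hT2, ContinuousConstSMul.secondCountableTopology, exists_isManifold_orbitQuotient hfree,
    isClosed_image_orbitProj hX hGX, fun d _ _ hπ => exists_whitneyAlgebra_algEquiv hπ X⟩
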